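/- **Conventions.** $\mathrm{Cat}$ is the 2-category of small categories and $\mathbf 1$ is the terminal category. A *prederivator* is a strict 2-functor $\mathbb D:\mathrm{Cat}^{op}\to\mathrm{CAT}$ (functors are reversed, natural transformations are not); for $f:J\to I$ in $\mathrm{Cat}$ write $f^*=\mathbb D(f):\mathbb D(I)\to\mathbb D(J)$. It is a *derivator* if 1. for every set-indexed family $(J_k)_k$ of small categories the canonical functor $\mathbb D(\coprod_k J_k)\to\prod_k\mathbb D(J_k)$ is an equivalence; 2. a morphism $\varphi$ of $\mathbb D(I)$ is an isomorphism if and only if $i^*\varphi$ is an isomorphism in $\mathbb D(\mathbf 1)$ for every object $i:\mathbf 1\to I$; 3. every $f^*$ has a left adjoint $f_!$ and a right adjoint $f_*$; 4. for every $f:I\to J$ and $j\in J$, with projections $p:f/j\to I$, $q:j/f\to I$ from the slice categories and $\mathrm{pt}$ denoting their functors to $\mathbf 1$, the canonical maps $\mathrm{pt}_!\,p^*\to j^*f_!$ and $j^*f_*\to \mathrm{pt}_*\,q^*$ are isomorphisms. For a small category $A$, the shift $\mathbb D^A$ is the prederivator $J\mapsto\mathbb D(A\times J)$; a functor $f:A\to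 B$ induces $f^*:\mathbb D^B\to\mathbb D^A$, given at $J$ by $(f\times\mathrm{id}_J)^*$. A functor $f:J\to I$ of small categories is a *homotopical epimorphism* if $f^*:\mathbb D(I)\to\mathbb D(J)$ is fully faithful for every derivator $\mathbb D$. Let $I$ be a small category. Let $\overset{\to}{\Delta}/I$ be the category whose objects are the functors $a:\{0<\dots<n\}\to I$ with $n\ge 0$, a morphism from $a:\{0<\dots<n\}\to I$ to $b:\{0<\dots<m\}\to I$ being a strictly increasing map $\varphi$ with $b\circ\varphi=a$. Put $A=(\overset{\to}{\Delta}/I)^{op}$, and let $u:A\to I$ be the functor with $u(a)=a(0)$ that sends a morphism $\varphi:a\to b$ of $\overset{\to}{\Delta}/I$ to the map $b(0)\to b(\varphi(0))=a(0)$. For $i\in I$ let $\iota_i:u^{-1}(i)\to A$ be the strict fibre of $u$ at $i$ (objects $a$ with $u(a)=i$, morphisms sent by $u$ to $\mathrm{id}_i$), and let $\mathrm{pt}_i:u^{-1}(i)\to\mathbf 1$ be the unique functor. **Proposition.** The functor $u:A\to I$ is a homotopical epimorphism. Moreover, let $\mathbb D$ be any derivator. For $J\in\mathrm{Cat}$ let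 $\mathcal E(J)\subseteq\mathbb D^A(J)$ be the full subcategory of those $\mathscr X$ such that, for every $i\in I$, $\iota_i^*\mathscr X$ is a constant diagram, that is, $$\iota_i^*\mathscr X\;\cong\;\mathrm{pt}_i^*\,\mathscr X_a\quad\text{in }\mathbb D^{u^{-1}(i)}(J)\text{ for every }a\in A\text{ with }u(a)=i,$$ where $\mathscr X_a=a^*\mathscr X\in\mathbb D^{\mathbf 1}(J)$. Then $u^*:\mathbb D^I\to\mathbb D^A$ is fully faithful at every $J$, its essential image at every $J$ is $\mathcal E(J)$, and $\mathcal E$ is a full sub-derivator of $\mathbb D^A$ (it is stable under all restriction functors and is itself a derivator). -/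

import Mathlib

open CategoryTheory Opposite

universe w v u

namespace HEpi

/-! ### Prederivators -/

/-- A prederivator: a strict 2-functor `Catᵒᵖ → CAT`.  Here `Cat.{w, w}` is the 2-category of small
categories, `ᵒᵖ` reverses functors but not natural transformations, and the values are arbitrary
categories (possibly large, in arbitrary universes). -/
abbrev Prederivator : Type _ := StrictPseudofunctor (Cat.{w, w})ᵒᵖ Cat.{v, u}

/-- The terminal category `𝟏`. -/
abbrev Pt : Type w := Discrete PUnit.{w + 1}

/-- An object `i` of `I`, seen as a functor `𝟏 ⥤ I`. -/
abbrev pick {I : Type w} [SmallCategory I] (i : I) : Pt.{w} ⥤ I := (Functor.const _).obj i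

/-- The unique functor `I ⥤ 𝟏`. -/
abbrev toPt (I : Type w) [SmallCategory I] : I ⥤ Pt.{w} := Functor.star I

namespace Prederivator

variable (D : Prederivator.{w, v, u})

/-- The category `𝔻(I)` of coherent diagrams of shape `I`. -/
abbrev Dia (I : Type w) [SmallCategory I] : Type u := D.obj (op (Cat.of I))

variable {I J K : Type w} [SmallCategory I] [SmallCategory J] [SmallCategory K]

/-- The restriction functor `f^* : 𝔻(I) ⥤ 𝔻(J)` along `f : J ⥤ I`. -/
abbrev res (f : J ⥤ I) : D.Dia I ⥤ D.Dia J := (D.map f.toCatHom.op).toFunctor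

/-- The natural transformation `α^* : f^* ⟶ g^*` induced by `α : f ⟶ g`. -/
abbrev resTrans {f g : J ⥤ I} (α : f ⟶ g) : D.res f ⟶ D.res g :=
  (D.map₂ (Bicategory.Opposite.op2 (NatTrans.toCatHom₂ α))).toNatTrans

/-- The identification `(f ⋙ g)^* = g^* ⋙ f^*` (an identity, as `𝔻` is strict), written as
an isomorphism. -/
abbrev resComp (f : K ⥤ J) (g : J ⥤ I) : D.res (f ⋙ g) ≅ D.res g ⋙ D.res f :=
  Cat.Hom.toNatIso (D.mapComp g.toCatHom.op f.toCatHom.op)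

/-- The 2-cell `f^* p^* ⟶ g^* q^*` induced by a 2-cell `p ⋙ f ⟶ q ⋙ g`. -/
def resSquare {L : Type w} [SmallCategory L] {p : L ⥤ J} {f : J ⥤ I} {q : L ⥤ K} {g : K ⥤ I}
    (α : p ⋙ f ⟶ q ⋙ g) : D.res f ⋙ D.res p ⟶ D.res g ⋙ D.res q :=
  (D.resComp p f).inv ≫ D.resTrans α ≫ (D.resComp q g).hom

end Prederivator

/-! ### The comma squares of the last axiom -/

section Comma

variable {I J : Type w} [SmallCategory I] [SmallCategory J]

/-- The canonical 2-cell over the slice `f / j`, whose component at `(i, φ : f i ⟶ j)` is `φ`. -/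
def sliceLeft (f : I ⥤ J) (j : J) :
    CostructuredArrow.proj f j ⋙ f ⟶ toPt (CostructuredArrow f j) ⋙ pick j where
  app x := x.hom
  naturality _ _ φ := (CostructuredArrow.w φ).trans (Category.comp_id _).symm

/-- The canonical 2-cell over the slice `j / f`, whose component at `(i, φ : j ⟶ f i)` is `φ`. -/
def sliceRight (f : I ⥤ J) (j : J) :
    toPt (StructuredArrow j f) ⋙ pick j ⟶ StructuredArrow.proj j f ⋙ f where
  app x := x.hom
  naturality _ _ φ := (Category.id_comp _).trans (StructuredArrow.w φ).symm

end Comma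

/-! ### Derivators -/

namespace Prederivator

variable (D : Prederivator.{w, v, u})

/-- The canonical functor `𝔻(∐ J_k) ⥤ ∏ 𝔻(J_k)`. -/
abbrev toProd {S : Type w} (J : S → Type w) [∀ k, SmallCategory (J k)] :
    D.Dia (Σ k, J k) ⥤ (∀ k, D.Dia (J k)) :=
  Functor.pi' fun k => D.res (Sigma.incl k)

/-- The canonical map `pt_! p^* ⟶ j^* f_!` in `𝔻(𝟏)`, where `p : f / j ⥤ I` is the projection:
the mate of the 2-cell `p^* f^* ⟶ pt^* j^*`. -/
def leftComparison {I J : Type w} [SmallCategory I] [SmallCategory J] (f : I ⥤ J) (j : J)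
    {fL : D.Dia I ⥤ D.Dia J} (adj : fL ⊣ D.res f)
    {hocolim : D.Dia (CostructuredArrow f j) ⥤ D.Dia Pt.{w}}
    (adj' : hocolim ⊣ D.res (toPt (CostructuredArrow f j))) :
    D.res (CostructuredArrow.proj f j) ⋙ hocolim ⟶ fL ⋙ D.res (pick j) :=
  ((mateEquiv adj adj').symm (.mk _ _ _ _ (D.resSquare (sliceLeft f j)))).natTrans

/-- The canonical map `j^* f_* ⟶ pt_* q^*` in `𝔻(𝟏)`, where `q : j / f ⥤ I` is the projection:
the mate of the 2-cell `pt^* j^* ⟶ q^* f^*`. -/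
def rightComparison {I J : Type w} [SmallCategory I] [SmallCategory J] (f : I ⥤ J) (j : J)
    {fR : D.Dia I ⥤ D.Dia J} (adj : D.res f ⊣ fR)
    {holim : D.Dia (StructuredArrow j f) ⥤ D.Dia Pt.{w}}
    (adj' : D.res (toPt (StructuredArrow j f)) ⊣ holim) :
    fR ⋙ D.res (pick j) ⟶ D.res (StructuredArrow.proj j f) ⋙ holim :=
  (mateEquiv adj adj' (.mk _ _ _ _ (D.resSquare (sliceRight f j)))).natTrans

/-- A derivator is a prederivator satisfying the four axioms below. -/
structure IsDerivator : Prop where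
  /-- `𝔻` sends disjoint unions to products, up to equivalence. -/
  der1 {S : Type w} (J : S → Type w) [∀ k, SmallCategory (J k)] : (D.toProd J).IsEquivalence
  /-- Isomorphisms are detected pointwise. -/
  der2 {I : Type w} [SmallCategory I] {X Y : D.Dia I} (φ : X ⟶ Y) :
    IsIso φ ↔ ∀ i : I, IsIso ((D.res (pick i)).map φ)
  /-- Left homotopy Kan extensions exist. -/
  der3_left {I J : Type w} [SmallCategory I] [SmallCategory J] (f : I ⥤ J) :
    (D.res f).IsRightAdjoint
  /-- Right homotopy Kan extensions exist. -/
  der3_right {I J : Type w} [SmallCategory I] [SmallCategory J] (f : I ⥤ J) :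
    (D.res f).IsLeftAdjoint
  /-- Left homotopy Kan extensions are computed pointwise. -/
  der4_left {I J : Type w} [SmallCategory I] [SmallCategory J] (f : I ⥤ J) (j : J)
    {fL : D.Dia I ⥤ D.Dia J} (adj : fL ⊣ D.res f)
    {hocolim : D.Dia (CostructuredArrow f j) ⥤ D.Dia Pt.{w}}
    (adj' : hocolim ⊣ D.res (toPt (CostructuredArrow f j))) :
    IsIso (D.leftComparison f j adj adj')
  /-- Right homotopy Kan extensions are computed pointwise. -/
  der4_right {I J : Type w} [SmallCategory I] [SmallCategory J] (f : I ⥤ J) (j : J)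
    {fR : D.Dia I ⥤ D.Dia J} (adj : D.res f ⊣ fR)
    {holim : D.Dia (StructuredArrow j f) ⥤ D.Dia Pt.{w}}
    (adj' : D.res (toPt (StructuredArrow j f)) ⊣ holim) :
    IsIso (D.rightComparison f j adj adj')

end Prederivator

/-- A functor `f : J ⥤ I` between small categories is a homotopical epimorphism if
`f^* : 𝔻(I) ⥤ 𝔻(J)` is fully faithful for every derivator `𝔻`. -/
def IsHomotopicalEpi {I J : Type w} [SmallCategory I] [SmallCategory J] (f : J ⥤ I) : Prop :=
  ∀ D : Prederivator.{w, v, u}, D.IsDerivator → (D.res f).Full ∧ (D.res f).Faithful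

/-! ### Shifts and full sub-prederivators -/

lemma op2_ext {B : Type*} [Bicategory B] {a b : Bᵒᵖ} {f g : a ⟶ b} {η θ : f ⟶ g}
    (h : Bicategory.Opposite.Hom2.unop2 η = Bicategory.Opposite.Hom2.unop2 θ) : η = θ :=
  congrArg Bicategory.Opposite.Hom2.op2' h

instance : Bicategory.Strict (Cat.{w, w})ᵒᵖ where
  id_comp _ := rfl
  comp_id _ := rfl
  assoc _ _ _ := rfl
  leftUnitor_eqToIso _ := rfl
  rightUnitor_eqToIso _ := rfl
  associator_eqToIso _ _ _ := rfl

/-- The strict 2-functor `J ↦ A × J` (on 1-cell duals). -/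
def prodLeft (A : Type w) [SmallCategory A] : StrictPseudofunctor (Cat.{w, w})ᵒᵖ (Cat.{w, w})ᵒᵖ :=
  StrictPseudofunctor.mk''
    { obj := fun J => op (Cat.of (A × J.unop))
      map := fun f => ((𝟭 A).prod f.unop.toFunctor).toCatHom.op
      map₂ := fun η => Bicategory.Opposite.op2
        (NatTrans.toCatHom₂ (NatTrans.prod (𝟙 (𝟭 A)) η.unop2.toNatTrans))
      map₂_id := by
        intros; apply op2_ext; ext x; apply Prod.hom_ext <;> rfl
      map₂_comp := by
        intros; apply op2_ext; ext x; apply Prod.hom_ext <;>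
          first | rfl | exact (Category.id_comp _).symm
      map_id := fun _ => rfl
      map_comp := fun _ _ => rfl
      map₂_whisker_left := by
        intros; apply op2_ext; ext x; apply Prod.hom_ext <;>
          exact ((Category.id_comp _).trans (Category.comp_id _)).symm
      map₂_whisker_right := by
        intros; apply op2_ext; ext x; apply Prod.hom_ext <;>
          exact ((Category.id_comp _).trans (Category.comp_id _)).symm }

namespace Prederivator

variable (D : Prederivator.{w, v, u})

/-- The shift `𝔻^A`, with `𝔻^A(J) = 𝔻(A × J)`. -/
def shift (A : Type w) [SmallCategory A] : Prederivator.{w, v, u} := (prodLeft A).comp D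

/-- The component `𝔻^B(J) ⥤ 𝔻^A(J)` of the morphism `f^* : 𝔻^B ⟶ 𝔻^A` induced by `f : A ⥤ B`. -/
abbrev shiftRes {A B : Type w} [SmallCategory A] [SmallCategory B] (f : A ⥤ B)
    (J : Type w) [SmallCategory J] : (D.shift B).Dia J ⥤ (D.shift A).Dia J :=
  D.res (f.prod (𝟭 J))

/-- Restriction along a functor `f : K ⥤ J` commutes with `g^* : 𝔻^B ⟶ 𝔻^A`. -/
def shiftResComm {A B : Type w} [SmallCategory A] [SmallCategory B] (g : A ⥤ B)
    {J K : Type w} [SmallCategory J] [SmallCategory K] (f : K ⥤ J) :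
    (D.shift B).res f ⋙ D.shiftRes g K ≅ D.shiftRes g J ⋙ (D.shift A).res f :=
  (D.resComp (g.prod (𝟭 K)) ((𝟭 B).prod f)).symm ≪≫
    D.resComp ((𝟭 A).prod f) (g.prod (𝟭 J))

lemma fullSub_functor_ext {C C' : Type*} [Category C] [Category C'] {P : ObjectProperty C'}
    {F G : C ⥤ P.FullSubcategory} (h : F ⋙ P.ι = G ⋙ P.ι) : F = G := by
  have hobj : ∀ X, F.obj X = G.obj X := fun X =>
    ObjectProperty.FullSubcategory.ext (Functor.congr_obj h X)
  have e : ∀ {X Y : P.FullSubcategory} (q : X = Y), P.ι.map (eqToHom q) = eqToHom (by rw [q]) := by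
    rintro X _ rfl; simp
  refine CategoryTheory.Functor.ext hobj fun X Y φ => P.ι.map_injective ?_
  rw [P.ι.map_comp, P.ι.map_comp, e, e]
  exact Functor.congr_hom h φ

lemma fullSub_eqToHom_app {C : Cat.{v, u}} {C' : Type u} [Category.{v} C']
    {P : ObjectProperty C'} {F G : C ⟶ Cat.of P.FullSubcategory} (h : F = G)
    {C'' : Cat.{v, u}} {F' G' : C'' ⟶ Cat.of C'} (h' : F' = G') (X : C) (X' : C'')
    (hF : (F.toFunctor.obj X).obj = F'.toFunctor.obj X')
    (hG : (G.toFunctor.obj X).obj = G'.toFunctor.obj X') :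
    HEq ((eqToHom h').toNatTrans.app X') ((eqToHom h).toNatTrans.app X).hom := by
  subst h h'
  simp only [eqToHom_refl]
  change HEq (𝟙 (F'.toFunctor.obj X')) (𝟙 (F.toFunctor.obj X).obj)
  have e : ∀ {x y : C'}, x = y → HEq (𝟙 x) (𝟙 y) := by rintro x _ rfl; rfl
  exact e hF.symm

lemma mapComp_hom_app {a b c : (Cat.{w, w})ᵒᵖ} (f : a ⟶ b) (g : b ⟶ c) (X : D.obj a) :
    (D.mapComp f g).hom.toNatTrans.app X = (eqToHom (D.map_comp f g)).toNatTrans.app X := by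
  rw [D.mapComp_eq_eqToIso]; rfl

lemma mapComp_inv_app {a b c : (Cat.{w, w})ᵒᵖ} (f : a ⟶ b) (g : b ⟶ c) (X : D.obj a) :
    (D.mapComp f g).inv.toNatTrans.app X = (eqToHom (D.map_comp f g).symm).toNatTrans.app X := by
  rw [D.mapComp_eq_eqToIso]; rfl

/-- The full sub-prederivator of `𝔻` on a family of classes of objects which is
stable under all restriction functors. -/
def fullSub (E : ∀ (J : Type w) [SmallCategory J], ObjectProperty (D.Dia J))
    (hE : ∀ {J K : Type w} [SmallCategory J] [SmallCategory K] (f : K ⥤ J) (X : D.Dia J),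
      E J X → E K ((D.res f).obj X)) : Prederivator.{w, v, u} :=
  StrictPseudofunctor.mk''
    { obj := fun J => Cat.of (E J.unop).FullSubcategory
      map := fun {J K} f => ((E K.unop).lift ((E J.unop).ι ⋙ (D.map f).toFunctor)
        fun X => hE f.unop.toFunctor X.obj X.property).toCatHom
      map₂ := fun η => NatTrans.toCatHom₂
        { app := fun X => ObjectProperty.homMk ((D.map₂ η).toNatTrans.app X.obj)
          naturality := fun _ _ _ => ObjectProperty.hom_ext _ ((D.map₂ η).toNatTrans.naturality _) }
      map₂_id := by
        intros; ext X; apply ObjectProperty.hom_ext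
        exact congr(($(D.map₂_id _)).toNatTrans.app X.obj)
      map₂_comp := by
        intros; ext X; apply ObjectProperty.hom_ext
        exact congr(($(D.map₂_comp _ _)).toNatTrans.app X.obj)
      map_id := by
        intros; apply Cat.ext; apply fullSub_functor_ext
        exact congr((E _).ι ⋙ ($(D.map_id _)).toFunctor)
      map_comp := by
        intros; apply Cat.ext; apply fullSub_functor_ext
        exact congr((E _).ι ⋙ ($(D.map_comp _ _)).toFunctor)
      map₂_whisker_left := by
        intros; ext X; apply ObjectProperty.hom_ext
        refine congr(($(D.map₂_whisker_left _ _)).toNatTrans.app X.obj).trans ?_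
        refine congrArg₂ (· ≫ ·) ?_ (congrArg₂ (· ≫ ·) rfl ?_)
        · exact (mapComp_hom_app D _ _ X.obj).trans
            (eq_of_heq (fullSub_eqToHom_app _ _ X X.obj rfl rfl))
        · exact (mapComp_inv_app D _ _ X.obj).trans
            (eq_of_heq (fullSub_eqToHom_app _ _ X X.obj rfl rfl))
      map₂_whisker_right := by
        intros; ext X; apply ObjectProperty.hom_ext
        refine congr(($(D.map₂_whisker_right _ _)).toNatTrans.app X.obj).trans ?_
        refine congrArg₂ (· ≫ ·) ?_ (congrArg₂ (· ≫ ·) rfl ?_)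
        · exact (mapComp_hom_app D _ _ X.obj).trans
            (eq_of_heq (fullSub_eqToHom_app _ _ X X.obj rfl rfl))
        · exact (mapComp_inv_app D _ _ X.obj).trans
            (eq_of_heq (fullSub_eqToHom_app _ _ X X.obj rfl rfl)) }

end Prederivator

/-! ### The category of chains -/

/-- The category `Δ→/I`: its objects are the functors `[n] ⥤ I` where `[n] = {0 < ⋯ < n}`. -/
structure Chain (I : Type w) [SmallCategory I] : Type w where
  /-- The length (one less than the number of objects of the chain). -/
  len : ℕ
  /-- The underlying functor. -/
  toFunctor : Fin (len + 1) ⥤ I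

namespace Chain

variable {I : Type w} [SmallCategory I]

/-- A morphism `a ⟶ b` is a strictly increasing map `φ` with `b ∘ φ = a`. -/
structure Hom (a b : Chain I) : Type w where
  /-- The underlying map. -/
  toFun : Fin (a.len + 1) → Fin (b.len + 1)
  /-- It is strictly increasing. -/
  strictMono : StrictMono toFun
  /-- It is compatible with the functors to `I`. -/
  comp_eq : strictMono.monotone.functor ⋙ b.toFunctor = a.toFunctor

@[ext]
lemma Hom.ext' {a b : Chain I} {f g : Hom a b} (h : f.toFun = g.toFun) : f = g := by
  cases f; cases g; cases h; rfl

instance : SmallCategory (Chain I) where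
  Hom a b := Hom a b
  id a := ⟨id, strictMono_id, rfl⟩
  comp {a b c} f g := ⟨g.toFun ∘ f.toFun, g.strictMono.comp f.strictMono, by
    rw [← f.comp_eq, ← g.comp_eq]; rfl⟩

end Chain

lemma first_aux {I : Type w} [SmallCategory I] {l m n : ℕ} {a : Fin (l + 1) ⥤ I}
    {b : Fin (m + 1) ⥤ I} {c : Fin (n + 1) ⥤ I} {f : Fin (l + 1) ⥤ Fin (m + 1)}
    {g : Fin (m + 1) ⥤ Fin (n + 1)} (hf : f ⋙ b = a) (hg : g ⋙ c = b) (h : (f ⋙ g) ⋙ c = a) :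
    c.map (homOfLE (Fin.zero_le _)) ≫ eqToHom (Functor.congr_obj h 0) =
    (c.map (homOfLE (Fin.zero_le (g.obj 0))) ≫ eqToHom (Functor.congr_obj hg 0)) ≫
      b.map (homOfLE (Fin.zero_le (f.obj 0))) ≫ eqToHom (Functor.congr_obj hf 0) := by
  subst hg hf
  change c.map _ ≫ 𝟙 _ = (c.map _ ≫ 𝟙 _) ≫ c.map (g.map _) ≫ 𝟙 _
  rw [Category.comp_id, Category.comp_id, Category.comp_id, ← c.map_comp]
  rfl

/-- The functor `u : (Δ→/I)ᵒᵖ ⥤ I` sending a chain `a` to its first object `a 0`.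
A morphism `φ : a ⟶ b` of chains is sent to `b 0 ⟶ b (φ 0) = a 0`. -/
def first (I : Type w) [SmallCategory I] : (Chain I)ᵒᵖ ⥤ I where
  obj a := a.unop.toFunctor.obj 0
  map {b a} φ := b.unop.toFunctor.map (homOfLE (Fin.zero_le (φ.unop.toFun 0))) ≫
    eqToHom (Functor.congr_obj φ.unop.comp_eq 0)
  map_id a := by
    refine (Category.comp_id _).trans ?_
    exact a.unop.toFunctor.map_id 0
  map_comp f g := first_aux g.unop.comp_eq f.unop.comp_eq (f ≫ g).unop.comp_eq

/-! ### Diagrams which are constant on the fibres -/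

section Fibres

variable (I : Type w) [SmallCategory I] (D : Prederivator.{w, v, u})

/-- The inclusion `ι_i : u⁻¹(i) ⥤ (Δ→/I)ᵒᵖ` of the strict fibre of `u` at `i`. -/
abbrev fibreIncl (i : I) : (first I).Fiber i ⥤ (Chain I)ᵒᵖ := Functor.Fiber.fiberInclusion

/-- The class `𝓔(J)` of the objects `X` of `𝔻^A(J)`, `A = (Δ→/I)ᵒᵖ`, such that for each `i` in `I`,
`ι_i^* X` is isomorphic in `𝔻^{u⁻¹(i)}(J)` to the constant diagram on `X_a`,
for every `a` in `A` with `u a = i`. -/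
def constantOnFibres (J : Type w) [SmallCategory J] :
    ObjectProperty ((D.shift (Chain I)ᵒᵖ).Dia J) := fun X =>
  ∀ (i : I) (a : (Chain I)ᵒᵖ), (first I).obj a = i →
    Nonempty ((D.shiftRes (fibreIncl I i) J).obj X ≅
      (D.shiftRes (toPt ((first I).Fiber i)) J).obj ((D.shiftRes (pick a) J).obj X))

lemma constantOnFibres_res {J K : Type w} [SmallCategory J] [SmallCategory K] (f : K ⥤ J)
    (X : (D.shift (Chain I)ᵒᵖ).Dia J) (hX : constantOnFibres I D J X) :
    constantOnFibres I D K (((D.shift (Chain I)ᵒᵖ).res f).obj X) := by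
  intro i a ha
  obtain ⟨e⟩ := hX i a ha
  exact ⟨(D.shiftResComm (fibreIncl I i) f).app X ≪≫
    ((D.shift _).res f).mapIso e ≪≫
    ((D.shiftResComm (toPt ((first I).Fiber i)) f).app _).symm ≪≫
    (D.shiftRes (toPt ((first I).Fiber i)) K).mapIso ((D.shiftResComm (pick a) f).app X).symm⟩

/-- The full sub-prederivator `𝓔 ⊆ 𝔻^A` of diagrams that are constant on the fibres of `u`. -/
def fibrewiseConstant : Prederivator.{w, v, u} :=
  (D.shift (Chain I)ᵒᵖ).fullSub (fun J _ => constantOnFibres I D J)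
    (fun f X hX => constantOnFibres_res I D f X hX)

end Fibres

end HEpi

/-! Write `u` for `first I`. For each `J`, the functor `u × J` is studied through its slices. An
object of the slice under `(i, j)` is a chain `a` with a map `i ⟶ a 0`, together with a map `j ⟶
j'`. Prepending `i` to the chain and resetting `j'` to `j` gives an endofunctor `T` of the slice.
Dropping the new head is a map `τ : T ⟶ 𝟭`; keeping only the head is a map `σ` from `T` to the
constant functor at `c`, the one-object chain `i`. All components of `σ`, and the component of `τ`
at `c`, come from morphisms in the fibres of `u`. Hence a diagram that is constant on the fibres
inverts them.

If `Z` on the slice inverts these maps, then `τ ∘ σ⁻¹ : pt^* c^* Z ⟶ Z` exhibits `c^* Z` as the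
homotopy limit of `Z` (`isCouniv_zigzagMap`). An arrow `pt^* S ⟶ Z` is then a limit cone exactly
when it is invertible at `c` (`isCouniv_iff_of_zigzag`). By the pointwise formula, the identity of
`u^* Y` is couniversal, which is full faithfulness (`fullyFaithful_of_zigzag`). For `X` constant on
the fibres, the counit `u^* u_* X ⟶ X` is invertible at the centre of each slice. The inclusion of
the head of a chain, again in a fibre, carries this to every object, so `X` is in the image
(`mem_essImage_of_zigzag`). Conversely `u ι_i` is constant, so a restriction along `u` is constant
on the fibres.

Thus `u^*` is an equivalence from `𝔻^I` to `𝓔`. Since `𝔻^I` is a derivator (`IsDerivator.shift`) and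
the axioms are invariant under equivalences compatible with restrictions and 2-cells
(`DiaEquiv.isDerivator`), `𝓔` is a derivator.

Kan extensions are handled throughout by single universal arrows `IsCouniv` and `IsUniv`. In these
terms the pointwise axiom says that pasting with a slice square (`slideR`, `slideL`) preserves
universality, and no adjoints or mates have to be chosen. -/

namespace HEpi

namespace Prederivator

/-! ### Componentwise calculus of a strict 2-functor -/

section Calculus

variable (D : Prederivator.{w, v, u})
variable {I J K L : Type w} [SmallCategory I] [SmallCategory J] [SmallCategory K] [SmallCategory L]

/-- The component at `X` of the identification `(f ⋙ g)^* ≅ g^* ⋙ f^*`. -/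
def cmp (f : K ⥤ J) (g : J ⥤ I) (X : D.Dia I) :
    (D.res (f ⋙ g)).obj X ≅ (D.res f).obj ((D.res g).obj X) :=
  (D.resComp f g).app X

/-- The component at `X` of the natural transformation `α^*`. -/
def tr {f g : J ⥤ I} (α : f ⟶ g) (X : D.Dia I) : (D.res f).obj X ⟶ (D.res g).obj X :=
  (D.resTrans α).app X

/-- The component at `X` of the identification `(𝟭 I)^* ≅ 𝟭`. -/
def unitIso (X : D.Dia I) : (D.res (𝟭 I)).obj X ≅ X :=
  (Cat.Hom.toNatIso (D.mapId (op (Cat.of I)))).app X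

lemma cmp_hom_naturality (f : K ⥤ J) (g : J ⥤ I) {X Y : D.Dia I} (φ : X ⟶ Y) :
    (D.res (f ⋙ g)).map φ ≫ (D.cmp f g Y).hom =
      (D.cmp f g X).hom ≫ (D.res f).map ((D.res g).map φ) :=
  (D.resComp f g).hom.naturality φ

lemma cmp_inv_naturality (f : K ⥤ J) (g : J ⥤ I) {X Y : D.Dia I} (φ : X ⟶ Y) :
    (D.res f).map ((D.res g).map φ) ≫ (D.cmp f g Y).inv =
      (D.cmp f g X).inv ≫ (D.res (f ⋙ g)).map φ :=
  (D.resComp f g).inv.naturality φ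

lemma tr_naturality {f g : J ⥤ I} (α : f ⟶ g) {X Y : D.Dia I} (φ : X ⟶ Y) :
    (D.res f).map φ ≫ D.tr α Y = D.tr α X ≫ (D.res g).map φ :=
  (D.resTrans α).naturality φ

lemma unitIso_hom_naturality {X Y : D.Dia I} (φ : X ⟶ Y) :
    (D.res (𝟭 I)).map φ ≫ (D.unitIso Y).hom = (D.unitIso X).hom ≫ φ :=
  (Cat.Hom.toNatIso (D.mapId (op (Cat.of I)))).hom.naturality φ

@[simp]
lemma tr_id (f : J ⥤ I) (X : D.Dia I) : D.tr (𝟙 f) X = 𝟙 _ :=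
  congr(($(D.map₂_id f.toCatHom.op)).toNatTrans.app X)

@[simp]
lemma tr_comp {f g h : J ⥤ I} (α : f ⟶ g) (β : g ⟶ h) (X : D.Dia I) :
    D.tr α X ≫ D.tr β X = D.tr (α ≫ β) X :=
  (congr(($(D.map₂_comp (Bicategory.Opposite.op2 (NatTrans.toCatHom₂ α))
    (Bicategory.Opposite.op2 (NatTrans.toCatHom₂ β)))).toNatTrans.app X)).symm

instance tr_isIso {f g : J ⥤ I} (α : f ⟶ g) [IsIso α] (X : D.Dia I) : IsIso (D.tr α X) :=
  ⟨D.tr (inv α) X, by simp, by simp⟩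

/-- The component at `X` of the isomorphism `f^* ≅ g^*` induced by `e : f ≅ g`. -/
@[simps]
def trIso {f g : J ⥤ I} (e : f ≅ g) (X : D.Dia I) : (D.res f).obj X ≅ (D.res g).obj X where
  hom := D.tr e.hom X
  inv := D.tr e.inv X

lemma tr_whiskerLeft (f : K ⥤ J) {g g' : J ⥤ I} (α : g ⟶ g') (X : D.Dia I) :
    D.tr (Functor.whiskerLeft f α) X =
      (D.cmp f g X).hom ≫ (D.res f).map (D.tr α X) ≫ (D.cmp f g' X).inv :=
  congr(($(D.map₂_whisker_right (Bicategory.Opposite.op2 (NatTrans.toCatHom₂ α))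
    f.toCatHom.op)).toNatTrans.app X)

lemma tr_whiskerRight {f f' : K ⥤ J} (α : f ⟶ f') (g : J ⥤ I) (X : D.Dia I) :
    D.tr (Functor.whiskerRight α g) X =
      (D.cmp f g X).hom ≫ D.tr α ((D.res g).obj X) ≫ (D.cmp f' g X).inv :=
  congr(($(D.map₂_whisker_left g.toCatHom.op
    (Bicategory.Opposite.op2 (NatTrans.toCatHom₂ α)))).toNatTrans.app X)

lemma res_map_tr (f : K ⥤ J) {g g' : J ⥤ I} (α : g ⟶ g') (X : D.Dia I) :
    (D.res f).map (D.tr α X) =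
      (D.cmp f g X).inv ≫ D.tr (Functor.whiskerLeft f α) X ≫ (D.cmp f g' X).hom := by
  simp [tr_whiskerLeft]

lemma tr_res {f f' : K ⥤ J} (α : f ⟶ f') (g : J ⥤ I) (X : D.Dia I) :
    D.tr α ((D.res g).obj X) =
      (D.cmp f g X).inv ≫ D.tr (Functor.whiskerRight α g) X ≫ (D.cmp f' g X).hom := by
  simp [tr_whiskerRight]

lemma cmp_assoc (f : L ⥤ K) (g : K ⥤ J) (h : J ⥤ I) (X : D.Dia I) :
    (D.cmp (f ⋙ g) h X).hom ≫ (D.cmp f g ((D.res h).obj X)).hom =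
      D.tr (Functor.associator f g h).hom X ≫ (D.cmp f (g ⋙ h) X).hom ≫
        (D.res f).map (D.cmp g h X).hom := by
  have h1 : (D.cmp (f ⋙ g) h X).hom ≫ (D.cmp f g ((D.res h).obj X)).hom =
      D.tr (Functor.associator f g h).hom X ≫ (D.cmp f (g ⋙ h) X).hom ≫
        (D.res f).map (D.cmp g h X).hom ≫ 𝟙 _ :=
    congr(($(D.mapComp_assoc_right_hom h.toCatHom.op g.toCatHom.op
      f.toCatHom.op)).toNatTrans.app X)
  rw [h1, Category.comp_id]

lemma cmp_id_left (g : J ⥤ I) (X : D.Dia I) :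
    (D.cmp (𝟭 J) g X).hom ≫ (D.unitIso ((D.res g).obj X)).hom =
      D.tr (Functor.leftUnitor g).hom X := by
  refine .trans ?_ (congr(($(D.map₂_right_unitor g.toCatHom.op)).toNatTrans.app X)).symm
  exact congr($rfl ≫ $((Category.comp_id _).symm))

lemma cmp_id_right (g : J ⥤ I) (X : D.Dia I) :
    (D.cmp g (𝟭 I) X).hom ≫ (D.res g).map (D.unitIso X).hom =
      D.tr (Functor.rightUnitor g).hom X := by
  refine .trans ?_ (congr(($(D.map₂_left_unitor g.toCatHom.op)).toNatTrans.app X)).symm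
  exact congr($rfl ≫ $((Category.comp_id _).symm))

lemma resSquare_app {p : L ⥤ J} {f : J ⥤ I} {q : L ⥤ K} {g : K ⥤ I}
    (α : p ⋙ f ⟶ q ⋙ g) (X : D.Dia I) :
    (D.resSquare α).app X = (D.cmp p f X).inv ≫ D.tr α X ≫ (D.cmp q g X).hom := rfl

end Calculus

end Prederivator

/-! ### Universal and couniversal arrows -/

section Universal

variable {C C' C'' : Type*} [Category C] [Category C'] [Category C'']

/-- `ε : F Y ⟶ X` is a couniversal arrow from `F` to `X`. -/
def IsCouniv (F : C ⥤ C') {Y : C} {X : C'} (ε : F.obj Y ⟶ X) : Prop :=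
  ∀ Z : C, Function.Bijective fun g : Z ⟶ Y => F.map g ≫ ε

/-- `η : X ⟶ F Y` is a universal arrow from `X` to `F`. -/
def IsUniv (F : C ⥤ C') {Y : C} {X : C'} (η : X ⟶ F.obj Y) : Prop :=
  ∀ Z : C, Function.Bijective fun g : Y ⟶ Z => η ≫ F.map g

variable {F : C ⥤ C'} {X : C'} {Y Y' : C}

/-- Uniqueness of universal objects, stated for a prescribed comparison map so that it can be
applied to maps obtained by restriction. -/
lemma IsCouniv.isIso {ε : F.obj Y ⟶ X} {ε' : F.obj Y' ⟶ X} (h : IsCouniv F ε)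
    (h' : IsCouniv F ε') (k : Y' ⟶ Y) (hk : F.map k ≫ ε = ε') : IsIso k := by
  obtain ⟨l, hl⟩ := (h' Y).2 ε
  dsimp at hl
  refine ⟨l, (h' _).1 ?_, (h _).1 ?_⟩ <;> simp [hl, hk]

lemma IsUniv.isIso {η : X ⟶ F.obj Y} {η' : X ⟶ F.obj Y'} (h : IsUniv F η)
    (h' : IsUniv F η') (k : Y ⟶ Y') (hk : η ≫ F.map k = η') : IsIso k := by
  obtain ⟨l, hl⟩ := (h' Y).2 η
  dsimp at hl
  refine ⟨l, (h _).1 ?_, (h' _).1 ?_⟩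
  · simp [reassoc_of% hk, hl]
  · simp [reassoc_of% hl, hk]

lemma IsCouniv.precomp {ε : F.obj Y ⟶ X} (h : IsCouniv F ε) (k : Y' ⟶ Y) [IsIso k] :
    IsCouniv F (F.map k ≫ ε) := by
  intro Z
  convert (h Z).comp (Iso.homToEquiv (asIso k) (Z := Z)).bijective using 1
  ext g
  simp

lemma IsUniv.postcomp {η : X ⟶ F.obj Y} (h : IsUniv F η) (k : Y ⟶ Y') [IsIso k] :
    IsUniv F (η ≫ F.map k) := by
  intro Z
  convert (h Z).comp (Iso.homFromEquiv (asIso k) (Z := Z)).symm.bijective using 1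
  ext g
  simp

lemma IsCouniv.postcomp {X' : C'} {ε : F.obj Y ⟶ X} (h : IsCouniv F ε) (k : X ⟶ X') [IsIso k] :
    IsCouniv F (ε ≫ k) := by
  intro Z
  convert (Iso.homToEquiv (asIso k)).bijective.comp (h Z) using 1
  ext g
  simp

lemma IsUniv.precomp {X' : C'} {η : X ⟶ F.obj Y} (h : IsUniv F η) (k : X' ⟶ X) [IsIso k] :
    IsUniv F (k ≫ η) := by
  intro Z
  convert (Iso.homFromEquiv (asIso k)).symm.bijective.comp (h Z) using 1
  ext g
  simp

lemma IsCouniv.counit {G : C' ⥤ C} (adj : F ⊣ G) (X : C') : IsCouniv F (adj.counit.app X) := by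
  intro Z
  have : (fun g : Z ⟶ G.obj X => F.map g ≫ adj.counit.app X) = (adj.homEquiv Z X).symm := by
    ext g
    simp [Adjunction.homEquiv_counit]
  exact this ▸ (adj.homEquiv Z X).symm.bijective

lemma IsUniv.unit {G : C' ⥤ C} (adj : G ⊣ F) (X : C') : IsUniv F (adj.unit.app X) := by
  intro Z
  have : (fun g : G.obj X ⟶ Z => adj.unit.app X ≫ F.map g) = adj.homEquiv X Z := by
    ext g
    simp [Adjunction.homEquiv_unit]
  exact this ▸ (adj.homEquiv X Z).bijective

lemma isLeftAdjoint_of_isCouniv (F : C ⥤ C')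
    (h : ∀ X, ∃ (Y : C) (ε : F.obj Y ⟶ X), IsCouniv F ε) : F.IsLeftAdjoint := by
  choose Y ε hε using h
  exact (Adjunction.adjunctionOfEquivRight (F := F) (G_obj := Y)
    (fun Z X => (Equiv.ofBijective _ (hε X Z)).symm) (by
      intro Z' Z X f g
      rw [Equiv.symm_apply_eq]
      change _ = F.map _ ≫ _
      rw [F.map_comp, Category.assoc]
      congr 1
      exact ((Equiv.ofBijective _ (hε X Z)).apply_symm_apply g).symm)).isLeftAdjoint

lemma isRightAdjoint_of_isUniv (F : C ⥤ C')
    (h : ∀ X, ∃ (Y : C) (η : X ⟶ F.obj Y), IsUniv F η) : F.IsRightAdjoint := by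
  choose Y η hη using h
  exact (Adjunction.adjunctionOfEquivLeft (G := F) (F_obj := Y)
    (fun X Z => Equiv.ofBijective _ (hη X Z)) (by
      intro X Z Z' f g
      simp)).isRightAdjoint

end Universal

namespace Prederivator

variable (D : Prederivator.{w, v, u})

/-! ### Pasting universal arrows with squares; the pointwise axiom -/

section Slide

variable {I J K L : Type w} [SmallCategory I] [SmallCategory J] [SmallCategory K] [SmallCategory L]

/-- The pasting of `ε : g^* Y ⟶ X` with a square. -/
def slideR {p : L ⥤ J} {f : J ⥤ I} {q : L ⥤ K} {g : K ⥤ I} (α : p ⋙ f ⟶ q ⋙ g)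
    {Y : D.Dia I} {X : D.Dia K} (ε : (D.res g).obj Y ⟶ X) :
    (D.res p).obj ((D.res f).obj Y) ⟶ (D.res q).obj X :=
  (D.resSquare α).app Y ≫ (D.res q).map ε

/-- The pasting of `η : X ⟶ f^* Y` with a square. -/
def slideL {p : L ⥤ J} {f : J ⥤ I} {q : L ⥤ K} {g : K ⥤ I} (α : p ⋙ f ⟶ q ⋙ g)
    {Y : D.Dia I} {X : D.Dia J} (η : X ⟶ (D.res f).obj Y) :
    (D.res p).obj X ⟶ (D.res q).obj ((D.res g).obj Y) :=
  (D.res p).map η ≫ (D.resSquare α).app Y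

variable {p : L ⥤ J} {f : J ⥤ I} {q : L ⥤ K} {g : K ⥤ I} (α : p ⋙ f ⟶ q ⋙ g)

lemma slideR_precomp {Y Y' : D.Dia I} {X : D.Dia K} (k : Y' ⟶ Y) (ε : (D.res g).obj Y ⟶ X) :
    D.slideR α ((D.res g).map k ≫ ε) = (D.res p).map ((D.res f).map k) ≫ D.slideR α ε := by
  have := (D.resSquare α).naturality k
  dsimp at this
  simp [slideR, reassoc_of% this]

lemma slideR_postcomp {Y : D.Dia I} {X X' : D.Dia K} (ε : (D.res g).obj Y ⟶ X) (k : X ⟶ X') :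
    D.slideR α (ε ≫ k) = D.slideR α ε ≫ (D.res q).map k := by
  simp [slideR]

lemma slideL_postcomp {Y Y' : D.Dia I} {X : D.Dia J} (η : X ⟶ (D.res f).obj Y) (k : Y ⟶ Y') :
    D.slideL α (η ≫ (D.res f).map k) = D.slideL α η ≫ (D.res q).map ((D.res g).map k) := by
  have := (D.resSquare α).naturality k
  dsimp at this
  simp [slideL, this]

lemma slideL_precomp {Y : D.Dia I} {X X' : D.Dia J} (η : X ⟶ (D.res f).obj Y) (k : X' ⟶ X) :
    D.slideL α (k ≫ η) = (D.res p).map k ≫ D.slideL α η := by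
  simp [slideL]

end Slide

section Comparison

variable {I J : Type w} [SmallCategory I] [SmallCategory J] (f : I ⥤ J) (j : J)

/-- The mate is the unique map through which the pasted counit factors over the counit of `adj'`. It
is therefore invertible precisely when the pasted arrow is itself couniversal. -/
lemma isIso_rightComparison_iff {fR : D.Dia I ⥤ D.Dia J} (adj : D.res f ⊣ fR)
    {holim : D.Dia (StructuredArrow j f) ⥤ D.Dia Pt.{w}}
    (adj' : D.res (toPt (StructuredArrow j f)) ⊣ holim) :
    IsIso (D.rightComparison f j adj adj') ↔ ∀ X, IsCouniv (D.res (toPt (StructuredArrow j f)))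
      (D.slideR (sliceRight f j) (adj.counit.app X)) := by
  have key (X) : (D.res (toPt (StructuredArrow j f))).map
      ((D.rightComparison f j adj adj').app X) ≫ adj'.counit.app _ =
        D.slideR (sliceRight f j) (adj.counit.app X) :=
    mateEquiv_counit adj adj' (.mk _ _ _ _ (D.resSquare (sliceRight f j))) X
  rw [NatTrans.isIso_iff_isIso_app]
  refine forall_congr' fun X => ⟨fun h => ?_, fun h => ?_⟩
  · rw [← key]
    exact (IsCouniv.counit adj' _).precomp _
  · exact (IsCouniv.counit adj' _).isIso h _ (key X)

lemma isIso_leftComparison_iff {fL : D.Dia I ⥤ D.Dia J} (adj : fL ⊣ D.res f)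
    {hocolim : D.Dia (CostructuredArrow f j) ⥤ D.Dia Pt.{w}}
    (adj' : hocolim ⊣ D.res (toPt (CostructuredArrow f j))) :
    IsIso (D.leftComparison f j adj adj') ↔ ∀ X, IsUniv (D.res (toPt (CostructuredArrow f j)))
      (D.slideL (sliceLeft f j) (adj.unit.app X)) := by
  have key (X) : adj'.unit.app _ ≫ (D.res (toPt (CostructuredArrow f j))).map
      ((D.leftComparison f j adj adj').app X) =
        D.slideL (sliceLeft f j) (adj.unit.app X) :=
    (unit_mateEquiv_symm adj adj' (.mk _ _ _ _ (D.resSquare (sliceLeft f j))) X).symm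
  rw [NatTrans.isIso_iff_isIso_app]
  refine forall_congr' fun X => ⟨fun h => ?_, fun h => ?_⟩
  · rw [← key]
    exact (IsUniv.unit adj' _).postcomp _
  · exact (IsUniv.unit adj' _).isIso h _ (key X)

end Comparison

/-- A derivator, in terms of universal arrows instead of adjunctions and mates. -/
lemma IsDerivator.of_universal
    (der1 : ∀ {S : Type w} (J : S → Type w) [∀ k, SmallCategory (J k)], (D.toProd J).IsEquivalence)
    (der2 : ∀ {I : Type w} [SmallCategory I] {X Y : D.Dia I} (φ : X ⟶ Y),
      IsIso φ ↔ ∀ i : I, IsIso ((D.res (pick i)).map φ))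
    (der3_left : ∀ {I J : Type w} [SmallCategory I] [SmallCategory J] (f : I ⥤ J) (X : D.Dia I),
      ∃ (Y : D.Dia J) (η : X ⟶ (D.res f).obj Y), IsUniv (D.res f) η)
    (der3_right : ∀ {I J : Type w} [SmallCategory I] [SmallCategory J] (f : I ⥤ J) (X : D.Dia I),
      ∃ (Y : D.Dia J) (ε : (D.res f).obj Y ⟶ X), IsCouniv (D.res f) ε)
    (der4_left : ∀ {I J : Type w} [SmallCategory I] [SmallCategory J] (f : I ⥤ J) (j : J)
      {X : D.Dia I} {Y : D.Dia J} (η : X ⟶ (D.res f).obj Y), IsUniv (D.res f) η →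
        IsUniv (D.res (toPt (CostructuredArrow f j))) (D.slideL (sliceLeft f j) η))
    (der4_right : ∀ {I J : Type w} [SmallCategory I] [SmallCategory J] (f : I ⥤ J) (j : J)
      {X : D.Dia I} {Y : D.Dia J} (ε : (D.res f).obj Y ⟶ X), IsCouniv (D.res f) ε →
        IsCouniv (D.res (toPt (StructuredArrow j f))) (D.slideR (sliceRight f j) ε)) :
    D.IsDerivator where
  der1 := der1
  der2 := der2
  der3_left f := isRightAdjoint_of_isUniv _ (der3_left f)
  der3_right f := isLeftAdjoint_of_isCouniv _ (der3_right f)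
  der4_left f j _ adj _ adj' := (D.isIso_leftComparison_iff f j adj adj').2 fun X =>
    der4_left f j _ (IsUniv.unit adj X)
  der4_right f j _ adj _ adj' := (D.isIso_rightComparison_iff f j adj adj').2 fun X =>
    der4_right f j _ (IsCouniv.counit adj X)

namespace IsDerivator

variable {D} (hD : D.IsDerivator)
variable {I J : Type w} [SmallCategory I] [SmallCategory J]
include hD

lemma exists_isCouniv (f : I ⥤ J) (X : D.Dia I) :
    ∃ (Y : D.Dia J) (ε : (D.res f).obj Y ⟶ X), IsCouniv (D.res f) ε :=
  have := hD.der3_right f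
  ⟨_, _, IsCouniv.counit (Adjunction.ofIsLeftAdjoint (D.res f)) X⟩

lemma exists_isUniv (f : I ⥤ J) (X : D.Dia I) :
    ∃ (Y : D.Dia J) (η : X ⟶ (D.res f).obj Y), IsUniv (D.res f) η :=
  have := hD.der3_left f
  ⟨_, _, IsUniv.unit (Adjunction.ofIsRightAdjoint (D.res f)) X⟩

/-- The axiom concerns counits of adjunctions; any other couniversal arrow differs from a counit by
an isomorphism of the source, which passes through the pasting. -/
lemma isCouniv_slideR (f : I ⥤ J) (j : J) {X : D.Dia I} {Y : D.Dia J}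
    {ε : (D.res f).obj Y ⟶ X} (h : IsCouniv (D.res f) ε) :
    IsCouniv (D.res (toPt (StructuredArrow j f))) (D.slideR (sliceRight f j) ε) := by
  have := hD.der3_right f
  have := hD.der3_right (toPt (StructuredArrow j f))
  let adj := Adjunction.ofIsLeftAdjoint (D.res f)
  obtain ⟨k, rfl⟩ := (IsCouniv.counit adj X Y).2 ε
  dsimp only at h ⊢
  have := (IsCouniv.counit adj X).isIso h k rfl
  rw [slideR_precomp]
  exact ((D.isIso_rightComparison_iff f j adj (Adjunction.ofIsLeftAdjoint _)).1
    (hD.der4_right f j _ _) X).precomp _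

lemma isUniv_slideL (f : I ⥤ J) (j : J) {X : D.Dia I} {Y : D.Dia J}
    {η : X ⟶ (D.res f).obj Y} (h : IsUniv (D.res f) η) :
    IsUniv (D.res (toPt (CostructuredArrow f j))) (D.slideL (sliceLeft f j) η) := by
  have := hD.der3_left f
  have := hD.der3_left (toPt (CostructuredArrow f j))
  let adj := Adjunction.ofIsRightAdjoint (D.res f)
  obtain ⟨k, rfl⟩ := (IsUniv.unit adj X Y).2 η
  dsimp only at h ⊢
  have := (IsUniv.unit adj X).isIso h k rfl
  rw [slideL_postcomp]
  exact ((D.isIso_leftComparison_iff f j adj (Adjunction.ofIsRightAdjoint _)).1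
    (hD.der4_left f j _ _) X).postcomp _

/-- Compare with a couniversal arrow that exists by the third axiom. At each `j` the comparison
relates two couniversal arrows, hence is invertible, and isomorphisms are detected pointwise. -/
lemma isCouniv_of_slices (f : I ⥤ J) {X : D.Dia I} {Y : D.Dia J} (ε : (D.res f).obj Y ⟶ X)
    (h : ∀ j, IsCouniv (D.res (toPt (StructuredArrow j f))) (D.slideR (sliceRight f j) ε)) :
    IsCouniv (D.res f) ε := by
  obtain ⟨Y₀, ε₀, h₀⟩ := hD.exists_isCouniv f X
  obtain ⟨k, rfl⟩ := (h₀ Y).2 ε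
  have : IsIso k := (hD.der2 k).2 fun j =>
    (hD.isCouniv_slideR f j h₀).isIso (h j) _ (D.slideR_precomp _ k ε₀).symm
  exact h₀.precomp k

lemma isUniv_of_slices (f : I ⥤ J) {X : D.Dia I} {Y : D.Dia J} (η : X ⟶ (D.res f).obj Y)
    (h : ∀ j, IsUniv (D.res (toPt (CostructuredArrow f j))) (D.slideL (sliceLeft f j) η)) :
    IsUniv (D.res f) η := by
  obtain ⟨Y₀, η₀, h₀⟩ := hD.exists_isUniv f X
  obtain ⟨k, rfl⟩ := (h₀ Y).2 η
  have : IsIso k := (hD.der2 k).2 fun j =>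
    (hD.isUniv_slideL f j h₀).isIso (h j) _ (D.slideL_postcomp _ η₀ k).symm
  exact h₀.postcomp k

end IsDerivator

end Prederivator

/-! ### Morphisms inverted by a coherent diagram -/

section PickMap

variable {I J : Type w} [SmallCategory I] [SmallCategory J]

/-- A morphism of `I`, seen as a natural transformation between functors `𝟏 ⥤ I`. -/
abbrev pickMap {x y : I} (m : x ⟶ y) : pick x ⟶ pick y := (Functor.const _).map m

/-- The identification of `f` applied to an object. -/
def pickComp (x : I) (f : I ⥤ J) : pick x ⋙ f ≅ pick (f.obj x) :=
  NatIso.ofComponents fun _ => Iso.refl _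

end PickMap

namespace Prederivator

variable {D : Prederivator.{w, v, u}}

section Inverts

variable {I J K : Type w} [SmallCategory I] [SmallCategory J] [SmallCategory K]

lemma isIso_tr_of_square {f f' g g' : J ⥤ I} {α : f ⟶ g} {β : f' ⟶ g'} (e : f ≅ f')
    (e' : g ≅ g') (h : α ≫ e'.hom = e.hom ≫ β) {X : D.Dia I} (hβ : IsIso (D.tr β X)) :
    IsIso (D.tr α X) := by
  have : α = e.hom ≫ β ≫ e'.inv := by simp [← reassoc_of% h]
  rw [this, ← D.tr_comp, ← D.tr_comp]
  infer_instance

lemma isIso_res_map_of_iso {f f' : J ⥤ I} (e : f ≅ f') {X Y : D.Dia I} {φ : X ⟶ Y}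
    (h : IsIso ((D.res f').map φ)) : IsIso ((D.res f).map φ) := by
  have := D.tr_naturality e.hom φ
  rw [← IsIso.eq_comp_inv] at this
  rw [this]
  infer_instance

lemma isIso_res_comp_map_iff (f : K ⥤ J) (g : J ⥤ I) {X Y : D.Dia I} (φ : X ⟶ Y) :
    IsIso ((D.res (f ⋙ g)).map φ) ↔ IsIso ((D.res f).map ((D.res g).map φ)) :=
  ⟨fun _ => (NatIso.isIso_map_iff (D.resComp f g) φ).1 ‹_›,
    fun _ => (NatIso.isIso_map_iff (D.resComp f g) φ).2 ‹_›⟩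

lemma isIso_pick_map_iff (x : K) (g : K ⥤ I) {X Y : D.Dia I} (φ : X ⟶ Y) :
    IsIso ((D.res (pick (g.obj x))).map φ) ↔ IsIso ((D.res (pick x)).map ((D.res g).map φ)) := by
  rw [← isIso_res_comp_map_iff]
  exact ⟨isIso_res_map_of_iso (pickComp x g), isIso_res_map_of_iso (pickComp x g).symm⟩

/-- The coherent diagram `X` sends the morphism `m` of `I` to an isomorphism. -/
def Inverts (X : D.Dia I) {x y : I} (m : x ⟶ y) : Prop := IsIso (D.tr (pickMap m) X)

lemma inverts_of_isIso (X : D.Dia I) {x y : I} (m : x ⟶ y) [IsIso m] : Inverts X m := by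
  unfold Inverts
  infer_instance

lemma Inverts.of_iso {X X' : D.Dia I} {x y : I} {m : x ⟶ y} (h : Inverts X m) (e : X ≅ X') :
    Inverts X' m := by
  have : IsIso (D.tr (pickMap m) X) := h
  have h1 := D.tr_naturality (pickMap m) e.hom
  rw [← IsIso.eq_inv_comp] at h1
  unfold Inverts
  rw [h1]
  infer_instance

lemma inverts_res_iff (f : J ⥤ I) (X : D.Dia I) {x y : J} (m : x ⟶ y) :
    Inverts ((D.res f).obj X) m ↔ Inverts X (f.map m) := by
  have h : IsIso (D.tr (pickMap m) ((D.res f).obj X)) ↔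
      IsIso (D.tr (Functor.whiskerRight (pickMap m) f) X) := by
    rw [tr_res, isIso_comp_left_iff, isIso_comp_right_iff]
  refine h.trans ⟨isIso_tr_of_square (pickComp x f).symm (pickComp y f).symm ?_,
    isIso_tr_of_square (pickComp x f) (pickComp y f) ?_⟩ <;>
  · ext
    simp [pickComp]

lemma isIso_pick_map_tr_iff (x : K) {f g : K ⥤ I} (α : f ⟶ g) (X : D.Dia I) :
    IsIso ((D.res (pick x)).map (D.tr α X)) ↔ Inverts X (α.app x) := by
  rw [res_map_tr, isIso_comp_left_iff, isIso_comp_right_iff]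
  refine ⟨isIso_tr_of_square (pickComp x f).symm (pickComp x g).symm ?_,
    isIso_tr_of_square (pickComp x f) (pickComp x g) ?_⟩ <;>
  · ext
    simp [pickComp]

/-- This reduces invertibility of `σ^*` on a diagram to a condition on the individual components of
`σ`. -/
lemma IsDerivator.isIso_tr_iff (hD : D.IsDerivator) {f g : K ⥤ I} (α : f ⟶ g) (X : D.Dia I) :
    IsIso (D.tr α X) ↔ ∀ x, Inverts X (α.app x) := by
  rw [hD.der2]
  exact forall_congr' fun x => isIso_pick_map_tr_iff x α X

/-- The composite `𝟏 ⥤ I ⥤ 𝟏` is the identity. -/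
def pickToPt (c : I) : pick c ⋙ toPt I ≅ 𝟭 Pt.{w} :=
  NatIso.ofComponents fun _ => Iso.refl _

/-- For a diagram of the form `pt^* S`, evaluation at an object gives back `S`. -/
noncomputable def evalConst (c : I) (S : D.Dia Pt.{w}) :
    S ≅ (D.res (pick c)).obj ((D.res (toPt I)).obj S) :=
  (D.unitIso S).symm ≪≫ asIso (D.tr (pickToPt c).inv S) ≪≫ D.cmp (pick c) (toPt I) S

lemma evalConst_naturality (c : I) {S S' : D.Dia Pt.{w}} (φ : S ⟶ S') :
    φ ≫ (evalConst c S').hom =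
      (evalConst c S).hom ≫ (D.res (pick c)).map ((D.res (toPt I)).map φ) := by
  have h := D.cmp_hom_naturality (pick c) (toPt I) φ
  simp only [evalConst, Iso.trans_hom, Iso.symm_hom, Category.assoc, asIso_hom]
  rw [← h, Iso.eq_inv_comp, ← reassoc_of% D.unitIso_hom_naturality φ,
    Iso.hom_inv_id_assoc, reassoc_of% D.tr_naturality]

end Inverts

/-! ### Homotopy limits over a category contracted by a zigzag -/

section Zigzag

variable {Y : Type w} [SmallCategory Y] {T : Y ⥤ Y} (τ : T ⟶ 𝟭 Y) {c : Y}
  (σ : T ⟶ toPt Y ⋙ pick c)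

instance isIso_tr_res_toPt {f g : Y ⥤ Y} (α : f ⟶ g) (S : D.Dia Pt.{w}) :
    IsIso (D.tr α ((D.res (toPt Y)).obj S)) := by
  rw [tr_res]
  have : IsIso (Functor.whiskerRight α (toPt Y)) :=
    ⟨⟨fun _ => eqToHom (Subsingleton.elim _ _), fun _ _ _ => Subsingleton.elim _ _⟩,
      by ext; exact Subsingleton.elim _ _, by ext; exact Subsingleton.elim _ _⟩
  infer_instance

/-- On a diagram pulled back from `𝟏`, the maps induced by `σ` and `τ` agree up to the canonical
identifications, because after composition with `toPt Y` nothing but parallel 2-cells into `𝟏`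
remains. -/
lemma res_toPt_evalConst (S : D.Dia Pt.{w}) :
    D.tr σ ((D.res (toPt Y)).obj S) ≫ (D.cmp (toPt Y) (pick c) _).hom =
      D.tr τ ((D.res (toPt Y)).obj S) ≫ (D.unitIso _).hom ≫
        (D.res (toPt Y)).map (evalConst c S).hom := by
  have h1 := D.cmp_assoc (toPt Y) (pick c) (toPt Y) S
  have h2 := D.cmp_id_left (toPt Y) S
  have h3 : (D.res (toPt Y)).map (D.unitIso S).inv =
      D.tr (Functor.rightUnitor (toPt Y)).inv S ≫ (D.cmp (toPt Y) (𝟭 _) S).hom := by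
    rw [← cancel_mono ((D.res (toPt Y)).map (D.unitIso S).hom), Category.assoc, cmp_id_right,
      ← Functor.map_comp, Iso.inv_hom_id, CategoryTheory.Functor.map_id, tr_comp, Iso.inv_hom_id,
      tr_id]
  have h4 : (D.res (toPt Y)).map (evalConst c S).hom =
      D.tr (Functor.rightUnitor (toPt Y)).inv S ≫
        D.tr (Functor.whiskerLeft (toPt Y) (pickToPt c).inv) S ≫
        (D.cmp (toPt Y) (pick c ⋙ toPt Y) S).hom ≫
        (D.res (toPt Y)).map (D.cmp (pick c) (toPt Y) S).hom := by
    simp [evalConst, h3, res_map_tr]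
  rw [D.tr_res σ, D.tr_res τ, h4]
  simp only [Category.assoc]
  rw [h1, reassoc_of% h2]
  simp only [← Category.assoc _ _ ((D.res (toPt Y)).map (D.cmp (pick c) (toPt Y) S).hom),
    ← Category.assoc _ _ (D.cmp (toPt Y) (pick c ⋙ toPt Y) S).hom, tr_comp]
  -- The remaining transformations are parallel with values in `𝟏`, so they coincide.
  congr 4

/-- The comparison map `pt^* c^* Z ⟶ Z` obtained by inverting `σ`. -/
noncomputable def zigzagMap (Z : D.Dia Y) [IsIso (D.tr σ Z)] :
    (D.res (toPt Y)).obj ((D.res (pick c)).obj Z) ⟶ Z :=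
  (D.cmp (toPt Y) (pick c) Z).inv ≫ inv (D.tr σ Z) ≫ D.tr τ Z ≫ (D.unitIso Z).hom

/-- The factorisation is explicit: every `κ` is recovered from its value at `c`. This uses
naturality in `κ` and the agreement of `σ` and `τ` on constant diagrams, but not the invertibility
of `τ` at `c`. -/
lemma zigzagMap_spec (Z : D.Dia Y) [IsIso (D.tr σ Z)] {S : D.Dia Pt.{w}}
    (κ : (D.res (toPt Y)).obj S ⟶ Z) :
    (D.res (toPt Y)).map ((evalConst c S).hom ≫ (D.res (pick c)).map κ) ≫ zigzagMap τ σ Z = κ := by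
  have h := res_toPt_evalConst τ σ S
  rw [← cancel_epi (D.unitIso ((D.res (toPt Y)).obj S)).hom,
    ← cancel_epi (D.tr τ ((D.res (toPt Y)).obj S)), Functor.map_comp]
  simp only [Category.assoc]
  rw [← reassoc_of% h, zigzagMap, ← D.unitIso_hom_naturality,
    ← reassoc_of% (D.tr_naturality τ κ)]
  have h2 := D.cmp_hom_naturality (toPt Y) (pick c) κ
  rw [← reassoc_of% h2, Iso.hom_inv_id_assoc, ← reassoc_of% (D.tr_naturality σ κ),
    IsIso.hom_inv_id_assoc]

lemma isIso_pick_map_zigzagMap (Z : D.Dia Y) [IsIso (D.tr σ Z)] (hτ : Inverts Z (τ.app c)) :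
    IsIso ((D.res (pick c)).map (zigzagMap τ σ Z)) := by
  have := (isIso_pick_map_tr_iff c τ Z).2 hτ
  rw [zigzagMap, Functor.map_comp, Functor.map_comp, Functor.map_comp]
  infer_instance

/-- Existence of factorisations is `zigzagMap_spec`. For uniqueness, evaluate at `c`: there the
zigzag map is invertible, and a map `S' ⟶ S` is determined by the value at `c` of its pullback. -/
lemma isCouniv_zigzagMap (Z : D.Dia Y) [IsIso (D.tr σ Z)] (hτ : Inverts Z (τ.app c)) :
    IsCouniv (D.res (toPt Y)) (zigzagMap τ σ Z) := by
  have := isIso_pick_map_zigzagMap τ σ Z hτ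
  refine fun S => ⟨fun g g' h => ?_, fun κ => ⟨_, zigzagMap_spec τ σ Z κ⟩⟩
  have h1 := congr((D.res (pick c)).map $h)
  simp only [Functor.map_comp] at h1
  rw [cancel_mono] at h1
  rw [← cancel_mono (evalConst c _).hom, evalConst_naturality, evalConst_naturality, h1]

-- Write `κ` as `pt^* k` followed by the zigzag map; both conditions then say that `k` is an
-- isomorphism.
include τ σ in
lemma isCouniv_iff_of_zigzag {Z : D.Dia Y} (hσ : IsIso (D.tr σ Z)) (hτ : Inverts Z (τ.app c))
    {S : D.Dia Pt.{w}} (κ : (D.res (toPt Y)).obj S ⟶ Z) :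
    IsCouniv (D.res (toPt Y)) κ ↔ IsIso ((D.res (pick c)).map κ) := by
  have h0 := isCouniv_zigzagMap τ σ Z hτ
  have h1 := isIso_pick_map_zigzagMap τ σ Z hτ
  obtain ⟨k, rfl⟩ := (h0 S).2 κ
  dsimp only
  refine ⟨fun h => ?_, fun h => ?_⟩
  · have := h0.isIso h k rfl
    rw [Functor.map_comp]
    infer_instance
  · rw [Functor.map_comp, isIso_comp_right_iff] at h
    have h2 := evalConst_naturality c k
    rw [← Iso.eq_comp_inv] at h2
    have : IsIso k := by
      rw [h2]
      infer_instance
    exact h0.precomp k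

/-- A constant diagram inverts every morphism, so both vertical maps of the naturality square of `κ`
along `m` are invertible. -/
lemma isIso_pick_map_of_inverts {Z : D.Dia Y} {S : D.Dia Pt.{w}}
    (κ : (D.res (toPt Y)).obj S ⟶ Z) {x y : Y} (m : x ⟶ y) (hm : Inverts Z m)
    (h : IsIso ((D.res (pick y)).map κ)) : IsIso ((D.res (pick x)).map κ) := by
  have h1 : IsIso (D.tr (pickMap m) Z) := hm
  have h2 : IsIso (D.tr (pickMap m) ((D.res (toPt Y)).obj S)) :=
    (inverts_res_iff (toPt Y) S m).2 (inverts_of_isIso S _)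
  have := D.tr_naturality (pickMap m) κ
  rw [← IsIso.eq_comp_inv] at this
  rw [this]
  infer_instance

end Zigzag

/-! ### Full faithfulness and essential image from contractible slices -/

section Epi

variable {A B : Type w} [SmallCategory A] [SmallCategory B]

/-- The component of the slice 2-cell at `y` is `y.hom`; when it is invertible, pasting does not
change the arrow at `y` up to isomorphism. -/
lemma isIso_pick_map_slideR_iff {f : A ⥤ B} {b : B} {X : D.Dia A} {Y : D.Dia B}
    (ε : (D.res f).obj Y ⟶ X) (y : StructuredArrow b f) [IsIso y.hom] :
    IsIso ((D.res (pick y)).map (D.slideR (sliceRight f b) ε)) ↔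
      IsIso ((D.res (pick y.right)).map ε) := by
  have h : IsIso ((D.res (pick y)).map (D.tr (sliceRight f b) Y)) := by
    rw [isIso_pick_map_tr_iff]
    have : IsIso ((sliceRight f b).app y) := ‹IsIso y.hom›
    exact inverts_of_isIso _ _
  rw [slideR, resSquare_app]
  simp only [Functor.map_comp, isIso_comp_left_iff]
  exact (isIso_pick_map_iff y (StructuredArrow.proj b f) ε).symm

/-- A zigzag contracting the slice `b / f` to an object. -/
structure SliceZigzag (f : A ⥤ B) (b : B) where
  /-- The intermediate endofunctor -/
  T : StructuredArrow b f ⥤ StructuredArrow b f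
  /-- The centre of the contraction -/
  c : StructuredArrow b f
  /-- The map to the identity -/
  τ : T ⟶ 𝟭 _
  /-- The map to the constant functor -/
  σ : T ⟶ toPt _ ⋙ pick c
  isIso_hom : IsIso c.hom

/-- The diagram `X` inverts the morphisms along which the slices of `f` are contracted. -/
structure SliceZigzag.Inverted {f : A ⥤ B} {b : B} (s : SliceZigzag f b) (X : D.Dia A) : Prop where
  σ_app (y) : Inverts X (s.σ.app y).right
  τ_app : Inverts X (s.τ.app s.c).right

namespace IsDerivator

variable (hD : D.IsDerivator)
include hD

lemma isCouniv_slideR_iff {f : A ⥤ B} {b : B} (s : SliceZigzag f b) {X : D.Dia A} {Y : D.Dia B}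
    (hX : s.Inverted X) (ε : (D.res f).obj Y ⟶ X) :
    IsCouniv (D.res (toPt _)) (D.slideR (sliceRight f b) ε) ↔
      IsIso ((D.res (pick s.c.right)).map ε) := by
  have := s.isIso_hom
  rw [← isIso_pick_map_slideR_iff]
  refine isCouniv_iff_of_zigzag s.τ s.σ ?_ ?_ _
  · rw [hD.isIso_tr_iff]
    exact fun y => (inverts_res_iff (StructuredArrow.proj b f) X _).2 (hX.σ_app y)
  · exact (inverts_res_iff (StructuredArrow.proj b f) X _).2 hX.τ_app

/-- Couniversality of the identity of `f^* X` says exactly that `f^*` is bijective on morphisms into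
`X`. On each slice it reduces to an identity being invertible at the centre. -/
lemma fullyFaithful_of_zigzag (f : A ⥤ B) (s : ∀ b, SliceZigzag f b)
    (hs : ∀ b (X : D.Dia B), (s b).Inverted ((D.res f).obj X)) :
    (D.res f).Full ∧ (D.res f).Faithful := by
  have key (X : D.Dia B) : IsCouniv (D.res f) (𝟙 ((D.res f).obj X)) :=
    hD.isCouniv_of_slices f _ fun b => by
      rw [hD.isCouniv_slideR_iff (s b) (hs b X)]
      infer_instance
  refine ⟨⟨fun {Z X} φ => ?_⟩, ⟨fun {Z X} g g' h => ?_⟩⟩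
  · obtain ⟨g, hg⟩ := (key X Z).2 φ
    exact ⟨g, by simpa using hg⟩
  · exact (key X Z).1 (by simpa using h)

/-- In the slice under `f a`, the pasted counit is invertible at the centre. The inverted map `m a`
transports this to the tautological object `(a, 𝟙)`, where the pasted counit is the counit at `a`.
-/
lemma mem_essImage_of_zigzag (f : A ⥤ B) (s : ∀ b, SliceZigzag f b) (X : D.Dia A)
    (hX : ∀ b, (s b).Inverted X)
    (m : ∀ a : A, StructuredArrow.mk (𝟙 (f.obj a)) ⟶ (s (f.obj a)).c)
    (hm : ∀ a, Inverts X (m a).right) : (D.res f).essImage X := by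
  obtain ⟨Y, ε, hε⟩ := hD.exists_isCouniv f X
  suffices IsIso ε from ⟨Y, ⟨asIso ε⟩⟩
  refine (hD.der2 ε).2 fun a => ?_
  have : IsIso (StructuredArrow.mk (𝟙 (f.obj a))).hom :=
    inferInstanceAs (IsIso (𝟙 (f.obj a)))
  have := (s (f.obj a)).isIso_hom
  refine (isIso_pick_map_slideR_iff ε (StructuredArrow.mk (𝟙 (f.obj a)))).1
    (isIso_pick_map_of_inverts _ (m a) ?_ ?_)
  · exact (inverts_res_iff (StructuredArrow.proj _ f) X _).2 (hm a)
  · rw [isIso_pick_map_slideR_iff, ← hD.isCouniv_slideR_iff _ (hX _)]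
    exact hD.isCouniv_slideR f _ hε

end IsDerivator

end Epi

end Prederivator

/-! ### Prepending an object to a chain -/

namespace Chain

variable {I : Type w} [SmallCategory I]

/-- The chain `i ⟶ a 0 ⟶ ⋯ ⟶ a n`. -/
def cons (a : Chain I) {i : I} (φ : i ⟶ a.toFunctor.obj 0) : Chain I :=
  ⟨a.len + 1, ComposableArrows.precomp a.toFunctor φ⟩

lemma precomp_map_zero_succ {n : ℕ} (F : Fin (n + 1) ⥤ I) {i : I} (φ : i ⟶ F.obj 0)
    (k : Fin (n + 1)) (h : (0 : Fin (n + 2)) ≤ k.succ) :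
    (ComposableArrows.precomp (X := i) F φ).map (homOfLE h) =
      φ ≫ F.map (homOfLE (Fin.zero_le k)) := by
  -- `precomp` has a separate clause for the arrow `0 ⟶ 1`, with value `φ` alone; there the identity
  -- `F.map (𝟙 0)` has to be inserted.
  induction k using Fin.cases with
  | zero =>
    exact (Category.comp_id φ).symm.trans congr(φ ≫ $((F.map_id 0).symm))
  | succ k => rfl

/-- The extension of a map between finite ordinals sending the new first element to itself. -/
def consFun {m n : ℕ} (g : Fin (m + 1) → Fin (n + 1)) : Fin (m + 2) → Fin (n + 2) :=
  Fin.cases 0 fun k => (g k).succ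

lemma strictMono_cons {m n : ℕ} {g : Fin (m + 1) → Fin (n + 1)} (hg : StrictMono g) :
    StrictMono (consFun g) := by
  intro x y hxy
  induction x using Fin.cases with
  | zero =>
    induction y using Fin.cases with
    | zero => exact absurd hxy (lt_irrefl _)
    | succ y => exact Fin.succ_pos _
  | succ x =>
    induction y using Fin.cases with
    | zero => exact absurd hxy (Fin.not_lt_zero _)
    | succ y => exact Fin.succ_lt_succ_iff.2 (hg (Fin.succ_lt_succ_iff.1 hxy))

lemma functor_comp_precomp {m n : ℕ} {g : Fin (m + 1) → Fin (n + 1)} (hg : StrictMono g)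
    (F : Fin (n + 1) ⥤ I) {i : I} (φ : i ⟶ F.obj 0) :
    (strictMono_cons hg).monotone.functor ⋙ ComposableArrows.precomp (X := i) F φ =
      ComposableArrows.precomp (X := i) (hg.monotone.functor ⋙ F)
        (φ ≫ F.map (homOfLE (Fin.zero_le (g 0)))) := by
  refine Functor.hext (fun x => ?_) fun x y f => ?_
  · induction x using Fin.cases <;> rfl
  · have hxy := leOfHom f
    rw [show f = homOfLE hxy from Subsingleton.elim _ _]
    induction x using Fin.cases with
    | zero =>
      induction y using Fin.cases with
      | zero => rfl
      | succ y =>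
        refine heq_of_eq (Eq.trans ?_ (precomp_map_zero_succ (hg.monotone.functor ⋙ F)
          (φ ≫ F.map (homOfLE (Fin.zero_le (g 0)))) y hxy).symm)
        refine (precomp_map_zero_succ F φ (g y) (Fin.zero_le _)).trans ?_
        rw [Category.assoc]
        congr 1
        exact F.map_comp (homOfLE (Fin.zero_le (g 0)))
          (homOfLE (hg.monotone (Fin.zero_le y)))
    | succ x =>
      induction y using Fin.cases with
      | zero => exact absurd hxy (not_le_of_gt (Fin.succ_pos _))
      | succ y => rfl

/-- The form matching `first`, whose values on morphisms carry an `eqToHom`. -/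
lemma functor_comp_precomp_eq {m n : ℕ} {g : Fin (m + 1) → Fin (n + 1)} (hg : StrictMono g)
    {F : Fin (n + 1) ⥤ I} {G : Fin (m + 1) ⥤ I} (hG : hg.monotone.functor ⋙ F = G) {i : I}
    (φ : i ⟶ F.obj 0) (ψ : i ⟶ G.obj 0)
    (h : φ ≫ F.map (homOfLE (Fin.zero_le (g 0))) ≫ eqToHom (Functor.congr_obj hG 0) = ψ) :
    (strictMono_cons hg).monotone.functor ⋙ ComposableArrows.precomp (X := i) F φ =
      ComposableArrows.precomp (X := i) G ψ := by
  subst hG h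
  refine (functor_comp_precomp hg F φ).trans ?_
  congr 2
  exact (Category.comp_id _).symm

/-- The functoriality of `cons`. -/
def consHom {a b : Chain I} (g : a ⟶ b) {i : I} (φ : i ⟶ b.toFunctor.obj 0)
    (ψ : i ⟶ a.toFunctor.obj 0) (h : φ ≫ (first I).map g.op = ψ) : a.cons ψ ⟶ b.cons φ where
  toFun := consFun g.toFun
  strictMono := strictMono_cons g.strictMono
  comp_eq := functor_comp_precomp_eq g.strictMono g.comp_eq φ ψ h

/-- The inclusion of the tail of a chain. -/
def tailHom (a : Chain I) {i : I} (φ : i ⟶ a.toFunctor.obj 0) : a ⟶ a.cons φ where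
  toFun := Fin.succ
  strictMono := Fin.strictMono_succ
  comp_eq := rfl

/-- The chain with one object. -/
def single (i : I) : Chain I := ⟨0, (Functor.const _).obj i⟩

/-- The inclusion of the first object of a chain. -/
def headHom (a : Chain I) {i : I} (h : a.toFunctor.obj 0 = i) : single i ⟶ a where
  toFun _ := 0
  strictMono := Subsingleton.strictMono (α := Fin 1) _
  comp_eq := by
    subst h
    refine Functor.hext (fun _ => rfl) fun x y f => heq_of_eq ?_
    exact a.toFunctor.map_id _

lemma first_map_consHom {a b : Chain I} (g : a ⟶ b) {i : I} (φ : i ⟶ b.toFunctor.obj 0)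
    (ψ : i ⟶ a.toFunctor.obj 0) (h : φ ≫ (first I).map g.op = ψ) :
    (first I).map (consHom g φ ψ h).op = 𝟙 i :=
  Category.comp_id _

lemma first_map_tailHom (a : Chain I) {i : I} (φ : i ⟶ a.toFunctor.obj 0) :
    (first I).map (tailHom a φ).op = φ :=
  Category.comp_id _

lemma first_map_headHom (a : Chain I) {i : I} (h : a.toFunctor.obj 0 = i) :
    (first I).map (headHom a h).op = eqToHom h := by
  subst h
  refine (Category.comp_id _).trans ?_
  exact a.toFunctor.map_id _

end Chain

/-! ### Contracting the slices of `u × J`; diagrams constant on the fibres -/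

section Slice

open Chain Prederivator

variable (I J : Type w) [SmallCategory I] [SmallCategory J]

/-- The functor `u × J : (Δ→/I)ᵒᵖ × J ⥤ I × J`. -/
abbrev firstProd : (Chain I)ᵒᵖ × J ⥤ I × J := (first I).prod (𝟭 J)

variable {I J}

/-- The endofunctor `(i ⟶ a 0, j ⟶ j') ↦ (i ⟶ a 0 ⟶ ⋯ ⟶ a n, j)` of a slice of `u × J`. -/
def sliceCons (x : I × J) :
    StructuredArrow x (firstProd I J) ⥤ StructuredArrow x (firstProd I J) where
  obj y := StructuredArrow.mk (Y := (op (y.right.1.unop.cons y.hom.1), x.2))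
    ((𝟙 x.1, 𝟙 x.2) : x ⟶ (x.1, x.2))
  map {y z} g := StructuredArrow.homMk
    ((consHom g.right.1.unop y.hom.1 z.hom.1 congr(($(StructuredArrow.w g)).1)).op, 𝟙 x.2) (by
      refine Prod.hom_ext ?_ (Category.id_comp _)
      exact (Category.id_comp _).trans (first_map_consHom _ _ _ _))
  map_id y := by
    refine StructuredArrow.hom_ext _ _ (Prod.hom_ext (Quiver.Hom.unop_inj (Hom.ext' ?_)) rfl)
    funext k
    induction k using Fin.cases <;> rfl
  map_comp f g := by
    refine StructuredArrow.hom_ext _ _ (Prod.hom_ext (Quiver.Hom.unop_inj (Hom.ext' ?_))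
      (Category.id_comp _).symm)
    funext k
    induction k using Fin.cases <;> rfl

/-- The slices of `u × J` are contractible. -/
def firstZigzag (x : I × J) : SliceZigzag (firstProd I J) x where
  T := sliceCons x
  c := StructuredArrow.mk (Y := (op (single x.1), x.2)) ((𝟙 x.1, 𝟙 x.2) : x ⟶ (x.1, x.2))
  τ :=
    { app y := StructuredArrow.homMk ((tailHom y.right.1.unop y.hom.1).op, y.hom.2) (by
        refine Prod.hom_ext ?_ (Category.id_comp _)
        exact (Category.id_comp _).trans (first_map_tailHom _ _))
      naturality y z g := by
        refine StructuredArrow.hom_ext _ _ (Prod.hom_ext rfl ?_)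
        refine (Category.id_comp _).trans ?_
        exact congr(($(StructuredArrow.w g)).2).symm }
  σ :=
    { app y := StructuredArrow.homMk ((headHom (y.right.1.unop.cons y.hom.1) rfl).op, 𝟙 x.2) (by
        refine Prod.hom_ext ?_ (Category.id_comp _)
        exact (Category.id_comp _).trans (first_map_headHom _ rfl))
      naturality y z g := rfl }
  isIso_hom := inferInstanceAs (IsIso (𝟙 x))

variable {D : Prederivator.{w, v, u}}

/-- A morphism over `𝟙 i` lives in the fibre, where `X` is pulled back along the projection to `𝟏 ×
J`, and `(m, 𝟙 j)` projects to an isomorphism. -/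
lemma inverts_of_constantOnFibres {X : (D.shift (Chain I)ᵒᵖ).Dia J}
    (hX : constantOnFibres I D J X) {a b : (Chain I)ᵒᵖ} (m : a ⟶ b) (i : I)
    [(first I).IsHomLift (𝟙 i) m] (j : J) :
    Inverts (D := D) (I := (Chain I)ᵒᵖ × J) X ((m, 𝟙 j) : (a, j) ⟶ (b, j)) := by
  obtain ⟨e⟩ := hX i a (IsHomLift.domain_eq (first I) (𝟙 i) m)
  let X' : D.Dia ((Chain I)ᵒᵖ × J) := X
  let e' : (D.res ((fibreIncl I i).prod (𝟭 J))).obj X' ≅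
    (D.res ((toPt ((first I).Fiber i)).prod (𝟭 J))).obj
      ((D.res ((pick a).prod (𝟭 J))).obj X') := e
  let mj := Prod.mkHom (Functor.Fiber.homMk (first I) i m) (𝟙 j)
  have : IsIso (((toPt ((first I).Fiber i)).prod (𝟭 J)).map mj) :=
    (isIso_prod_iff _ _).2 ⟨inferInstance, inferInstanceAs (IsIso (𝟙 j))⟩
  exact (inverts_res_iff ((fibreIncl I i).prod (𝟭 J)) X' mj).1
    (((inverts_res_iff _ _ mj).2 (inverts_of_isIso _ _)).of_iso e'.symm)

lemma isHomLift_first {a b : (Chain I)ᵒᵖ} (m : a ⟶ b) {i : I} (ha : (first I).obj a = i)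
    (hb : (first I).obj b = i) (h : (first I).map m = eqToHom (ha.trans hb.symm)) :
    (first I).IsHomLift (𝟙 i) m :=
  IsHomLift.of_fac' _ _ _ ha hb (by simp [h])

/-- Inclusions of heads always lie in a fibre. The inclusion of a tail lies over the prepended arrow
`φ`, so in general it does not; at the centre, however, `φ` is an identity. -/
lemma firstZigzag_inverted {X : (D.shift (Chain I)ᵒᵖ).Dia J} (hX : constantOnFibres I D J X)
    (x : I × J) : (firstZigzag x).Inverted (D := D) X where
  σ_app y :=
    have := isHomLift_first (headHom (y.right.1.unop.cons y.hom.1) rfl).op (i := x.1) rfl rfl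
      (first_map_headHom _ rfl)
    inverts_of_constantOnFibres hX (headHom (y.right.1.unop.cons y.hom.1) rfl).op x.1 x.2
  τ_app :=
    have := isHomLift_first (tailHom (single x.1) (𝟙 x.1)).op (i := x.1) rfl rfl
      (first_map_tailHom _ _)
    inverts_of_constantOnFibres hX (tailHom (single x.1) (𝟙 x.1)).op x.1 x.2

/-- The composite of `u` with the inclusion of a fibre is isomorphic to a constant functor. -/
lemma constantOnFibres_shiftRes (Y : (D.shift I).Dia J) :
    constantOnFibres I D J ((D.shiftRes (first I) J).obj Y) := by
  intro i a ha
  let e : fibreIncl I i ⋙ first I ≅ toPt ((first I).Fiber i) ⋙ pick a ⋙ first I :=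
    Functor.Fiber.fiberInclusionCompIsoConst ≪≫ NatIso.ofComponents (fun _ => eqToIso ha.symm)
  let e' : (fibreIncl I i).prod (𝟭 J) ⋙ firstProd I J ≅
      (toPt ((first I).Fiber i)).prod (𝟭 J) ⋙ (pick a).prod (𝟭 J) ⋙ firstProd I J :=
    NatIso.ofComponents (fun y => Iso.prod (e.app y.1) (Iso.refl y.2)) (by
      intro y z g
      refine Prod.hom_ext (e.hom.naturality g.1) ?_
      exact (Category.comp_id g.2).trans (Category.id_comp g.2).symm)
  exact ⟨(D.cmp _ (firstProd I J) Y).symm ≪≫ D.trIso e' Y ≪≫ D.cmp _ _ Y ≪≫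
    (D.res _).mapIso (D.cmp _ _ Y)⟩

namespace Prederivator.IsDerivator

variable (hD : D.IsDerivator)
include hD

lemma fullyFaithful_shiftRes_first : (D.shiftRes (first I) J).Full ∧
    (D.shiftRes (first I) J).Faithful :=
  hD.fullyFaithful_of_zigzag (firstProd I J) firstZigzag fun x X =>
    firstZigzag_inverted (constantOnFibres_shiftRes X) x

lemma essImage_shiftRes_first :
    (D.shiftRes (first I) J).essImage = constantOnFibres I D J := by
  ext X
  refine ⟨?_, fun hX => ?_⟩
  · rintro ⟨Y, ⟨e⟩⟩ i a ha
    obtain ⟨e'⟩ := constantOnFibres_shiftRes Y i a ha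
    exact ⟨(D.shiftRes _ J).mapIso e.symm ≪≫ e' ≪≫
      (D.shiftRes _ J).mapIso ((D.shiftRes _ J).mapIso e)⟩
  -- In the opposite category, the inclusion of the head of `a` is a map from `a` to the one-object
  -- chain, i.e. to the centre of the slice.
  · refine hD.mem_essImage_of_zigzag (firstProd I J) firstZigzag X (firstZigzag_inverted hX)
      (fun a => StructuredArrow.homMk ((headHom a.1.unop rfl).op, 𝟙 a.2) ?_) fun a => ?_
    · refine Prod.hom_ext ?_ (Category.id_comp _)
      exact (Category.id_comp _).trans (first_map_headHom _ rfl)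
    · have := isHomLift_first (headHom a.1.unop rfl).op (i := (first I).obj a.1) rfl rfl
        (first_map_headHom _ rfl)
      exact inverts_of_constantOnFibres hX (headHom a.1.unop rfl).op ((first I).obj a.1) a.2

end Prederivator.IsDerivator

end Slice

namespace Prederivator

variable {D : Prederivator.{w, v, u}}

/-! ### Pasting of squares and replacement by equivalent squares -/

section Paste

variable {I J K L L' M : Type w} [SmallCategory I] [SmallCategory J] [SmallCategory K]
  [SmallCategory L] [SmallCategory L'] [SmallCategory M]

/-- The natural isomorphism `f^* ⋙ g^* ≅ 𝟭` for mutually inverse functors. -/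
def resInvIso {f : J ⥤ I} {g : I ⥤ J} (e : g ⋙ f ≅ 𝟭 I) : D.res f ⋙ D.res g ≅ 𝟭 (D.Dia I) :=
  NatIso.ofComponents (fun X => (D.cmp g f X).symm ≪≫ D.trIso e X ≪≫ D.unitIso X) (by
    intro X Y φ
    have h1 := D.cmp_inv_naturality g f φ
    have h2 := D.tr_naturality e.hom φ
    have h3 := D.unitIso_hom_naturality φ
    simp [reassoc_of% h1, reassoc_of% h2, h3])

instance res_isEquivalence (f : J ⥤ I) [f.IsEquivalence] : (D.res f).IsEquivalence :=
  (CategoryTheory.Equivalence.mk (D.res f) (D.res f.inv)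
    (resInvIso f.asEquivalence.counitIso).symm
    (resInvIso f.asEquivalence.unitIso.symm)).isEquivalence_functor

variable (D) in
lemma cmp_assoc_symm (f : L ⥤ K) (g : K ⥤ J) (h : J ⥤ I) (X : D.Dia I) :
    (D.cmp f (g ⋙ h) X).hom ≫ (D.res f).map (D.cmp g h X).hom =
      D.tr (Functor.associator f g h).inv X ≫ (D.cmp (f ⋙ g) h X).hom ≫
        (D.cmp f g ((D.res h).obj X)).hom := by
  rw [cmp_assoc, ← Category.assoc, tr_comp, Iso.inv_hom_id, tr_id, Category.id_comp]

variable (D) in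
lemma cmp_inv_assoc (f : L ⥤ K) (g : K ⥤ J) (h : J ⥤ I) (X : D.Dia I) :
    (D.cmp f g ((D.res h).obj X)).inv ≫ (D.cmp (f ⋙ g) h X).inv =
      (D.res f).map (D.cmp g h X).inv ≫ (D.cmp f (g ⋙ h) X).inv ≫
        D.tr (Functor.associator f g h).inv X := by
  rw [← cancel_epi (D.cmp f g ((D.res h).obj X)).hom, ← cancel_epi (D.cmp (f ⋙ g) h X).hom,
    Iso.hom_inv_id_assoc, Iso.hom_inv_id, reassoc_of% cmp_assoc, ← Functor.map_comp_assoc,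
    Iso.hom_inv_id, CategoryTheory.Functor.map_id, Category.id_comp, Iso.hom_inv_id_assoc,
    tr_comp, Iso.hom_inv_id, tr_id]

variable (D) in
lemma cmp_inv_assoc_symm (f : L ⥤ K) (g : K ⥤ J) (h : J ⥤ I) (X : D.Dia I) :
    (D.res f).map (D.cmp g h X).inv ≫ (D.cmp f (g ⋙ h) X).inv =
      (D.cmp f g ((D.res h).obj X)).inv ≫ (D.cmp (f ⋙ g) h X).inv ≫
        D.tr (Functor.associator f g h).hom X := by
  rw [reassoc_of% cmp_inv_assoc, tr_comp, Iso.inv_hom_id, tr_id, Category.comp_id]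

variable {p : L ⥤ J} {f : J ⥤ I} {q : L ⥤ K} {g : K ⥤ I} (α : p ⋙ f ⟶ q ⋙ g)

/-- The pasting of a square with a square attached to its left leg. -/
def pasteRight {p' : L' ⥤ M} {f' : M ⥤ J} {q' : L' ⥤ L} (β : p' ⋙ f' ⟶ q' ⋙ p) :
    p' ⋙ f' ⋙ f ⟶ (q' ⋙ q) ⋙ g :=
  (Functor.associator p' f' f).inv ≫ Functor.whiskerRight β f ≫
    (Functor.associator q' p f).hom ≫ Functor.whiskerLeft q' α ≫
      (Functor.associator q' q g).inv

/-- The pasting of a square with a square attached to its right leg. -/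
def pasteLeft {p' : L' ⥤ L} {g' : M ⥤ K} {q' : L' ⥤ M} (β : p' ⋙ q ⟶ q' ⋙ g') :
    (p' ⋙ p) ⋙ f ⟶ q' ⋙ g' ⋙ g :=
  (Functor.associator p' p f).hom ≫ Functor.whiskerLeft p' α ≫
    (Functor.associator p' q g).inv ≫ Functor.whiskerRight β g ≫
      (Functor.associator q' g' g).hom

lemma pasteRight_app {p' : L' ⥤ M} {f' : M ⥤ J} {q' : L' ⥤ L} (β : p' ⋙ f' ⟶ q' ⋙ p) (x : L') :
    (pasteRight α β).app x = f.map (β.app x) ≫ α.app (q'.obj x) := by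
  simp [pasteRight]

lemma pasteLeft_app {p' : L' ⥤ L} {g' : M ⥤ K} {q' : L' ⥤ M} (β : p' ⋙ q ⟶ q' ⋙ g') (x : L') :
    (pasteLeft α β).app x = α.app (p'.obj x) ≫ g.map (β.app x) := by
  simp [pasteLeft]

lemma resSquare_pasteRight {p' : L' ⥤ M} {f' : M ⥤ J} {q' : L' ⥤ L} (β : p' ⋙ f' ⟶ q' ⋙ p)
    (Y : D.Dia I) :
    (D.resSquare β).app ((D.res f).obj Y) ≫ (D.res q').map ((D.resSquare α).app Y) =
      (D.res p').map (D.cmp f' f Y).inv ≫ (D.resSquare (pasteRight α β)).app Y ≫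
        (D.cmp q' q _).hom := by
  simp only [resSquare_app, tr_res, Functor.map_comp, res_map_tr, Category.assoc, pasteRight]
  rw [reassoc_of% D.cmp_inv_assoc p' f' f Y, reassoc_of% D.cmp_assoc q' p f Y,
    ← Functor.map_comp_assoc, Iso.hom_inv_id, CategoryTheory.Functor.map_id, Category.id_comp,
    Iso.hom_inv_id_assoc, D.cmp_assoc_symm q' q g Y]
  simp only [← D.tr_comp, Category.assoc]

lemma resSquare_pasteLeft {p' : L' ⥤ L} {g' : M ⥤ K} {q' : L' ⥤ M} (β : p' ⋙ q ⟶ q' ⋙ g')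
    (Y : D.Dia I) :
    (D.res p').map ((D.resSquare α).app Y) ≫ (D.resSquare β).app ((D.res g).obj Y) =
      (D.cmp p' p _).inv ≫ (D.resSquare (pasteLeft α β)).app Y ≫
        (D.res q').map (D.cmp g' g Y).hom := by
  simp only [resSquare_app, tr_res, Functor.map_comp, res_map_tr, Category.assoc, pasteLeft]
  rw [reassoc_of% D.cmp_inv_assoc_symm p' p f Y, reassoc_of% D.cmp_assoc_symm p' q g Y,
    Iso.hom_inv_id_assoc, Iso.hom_inv_id_assoc, D.cmp_assoc q' g' g Y]
  simp only [← D.tr_comp, Category.assoc]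

variable (p f q g) in
/-- The whiskering of a square. -/
def whiskerSquare (e : L' ⥤ L) : (e ⋙ p) ⋙ f ⟶ (e ⋙ q) ⋙ g :=
  (Functor.associator e p f).hom ≫ Functor.whiskerLeft e α ≫ (Functor.associator e q g).inv

lemma whiskerSquare_app (e : L' ⥤ L) (x : L') :
    (whiskerSquare p f q g α e).app x = α.app (e.obj x) := by
  simp [whiskerSquare]

lemma res_map_resSquare (e : L' ⥤ L) (Y : D.Dia I) :
    (D.res e).map ((D.resSquare α).app Y) = (D.cmp e p ((D.res f).obj Y)).inv ≫
      (D.resSquare (whiskerSquare p f q g α e)).app Y ≫ (D.cmp e q _).hom := by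
  simp only [resSquare_app, Functor.map_comp, res_map_tr, Category.assoc, whiskerSquare]
  rw [reassoc_of% D.cmp_inv_assoc_symm e p f Y, D.cmp_assoc_symm e q g Y]
  simp only [← D.tr_comp, Category.assoc]

/-- Functoriality of `resSquare` in all four sides; it permits replacing a square by one with
isomorphic sides. -/
lemma resSquare_congr {p₁ : L ⥤ J} {f₁ : J ⥤ I} {q₁ : L ⥤ K} {g₁ : K ⥤ I}
    (α₁ : p₁ ⋙ f₁ ⟶ q₁ ⋙ g₁) (a : p ⟶ p₁) (b : f ⟶ f₁) (c : q ⟶ q₁) (d : g ⟶ g₁)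
    (h : α ≫ Functor.whiskerRight c g ≫ Functor.whiskerLeft q₁ d =
      Functor.whiskerRight a f ≫ Functor.whiskerLeft p₁ b ≫ α₁) (Y : D.Dia I) :
    (D.resSquare α).app Y ≫ D.tr c _ ≫ (D.res q₁).map (D.tr d Y) =
      D.tr a _ ≫ (D.res p₁).map (D.tr b Y) ≫ (D.resSquare α₁).app Y := by
  simp only [resSquare_app, tr_res, res_map_tr, Category.assoc, Iso.hom_inv_id_assoc]
  congr 1
  simp only [← Category.assoc]
  congr 1
  simp only [tr_comp, Category.assoc, h]

lemma slideR_slideR {p' : L' ⥤ M} {f' : M ⥤ J} {q' : L' ⥤ L} (β : p' ⋙ f' ⟶ q' ⋙ p)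
    {Y : D.Dia I} {X : D.Dia K} (ε : (D.res g).obj Y ⟶ X) :
    D.slideR β (D.slideR α ε) = (D.res p').map (D.cmp f' f Y).inv ≫
      D.slideR (pasteRight α β) ε ≫ (D.cmp q' q X).hom := by
  have h1 := resSquare_pasteRight α β Y
  have h2 := D.cmp_hom_naturality q' q ε
  simp only [slideR, Functor.map_comp, Category.assoc, h2]
  rw [← Category.assoc, ← Category.assoc, ← Category.assoc]
  exact congr($(by simpa using h1) ≫ _)

lemma slideL_slideL {p' : L' ⥤ L} {g' : M ⥤ K} {q' : L' ⥤ M} (β : p' ⋙ q ⟶ q' ⋙ g')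
    {Y : D.Dia I} {X : D.Dia J} (η : X ⟶ (D.res f).obj Y) :
    D.slideL β (D.slideL α η) = (D.cmp p' p X).inv ≫ D.slideL (pasteLeft α β) η ≫
      (D.res q').map (D.cmp g' g Y).hom := by
  have h1 := resSquare_pasteLeft α β Y
  have h2 := D.cmp_inv_naturality p' p η
  simp only [slideL, Functor.map_comp, Category.assoc, ← reassoc_of% h2]
  exact congr(_ ≫ $(by simpa using h1))

lemma slideR_of_equivalence (e : L' ⥤ L) {p₁ : L' ⥤ J} {f₁ : J ⥤ I} {q₁ : L' ⥤ K}
    (α₁ : p₁ ⋙ f₁ ⟶ q₁ ⋙ g) (a : p₁ ≅ e ⋙ p) (b : f₁ ≅ f) (c : q₁ ≅ e ⋙ q)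
    (h : α₁ ≫ Functor.whiskerRight c.hom g = Functor.whiskerRight a.hom f₁ ≫
      Functor.whiskerLeft (e ⋙ p) b.hom ≫ whiskerSquare p f q g α e)
    {Y : D.Dia I} {X : D.Dia K} (ε : (D.res g).obj Y ⟶ X) :
    D.slideR α₁ ε = (D.res p₁).map (D.tr b.hom Y) ≫ (D.tr a.hom _ ≫ (D.cmp e p _).hom ≫
      (D.res e).map (D.slideR α ε)) ≫ (D.cmp e q X).inv ≫ D.tr c.inv X := by
  have h1 := resSquare_congr α₁ (whiskerSquare p f q g α e) a.hom b.hom c.hom (𝟙 g)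
    (by simpa using h) Y
  rw [tr_id, CategoryTheory.Functor.map_id, Category.comp_id] at h1
  have h2 := D.cmp_inv_naturality e q ε
  rw [← cancel_mono (D.trIso c X).hom]
  simp only [slideR, Functor.map_comp, res_map_resSquare, Category.assoc, trIso_hom, tr_comp,
    Iso.inv_hom_id, tr_id, Category.comp_id, D.tr_naturality, Iso.hom_inv_id_assoc, h2]
  rw [reassoc_of% h1, ← reassoc_of% D.tr_naturality a.hom]

lemma slideL_of_equivalence (e : L' ⥤ L) {p₁ : L' ⥤ J} {g₁ : K ⥤ I} {q₁ : L' ⥤ K}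
    (α₁ : p₁ ⋙ f ⟶ q₁ ⋙ g₁) (a : p₁ ≅ e ⋙ p) (b : g₁ ≅ g) (c : q₁ ≅ e ⋙ q)
    (h : α₁ ≫ Functor.whiskerRight c.hom g₁ ≫ Functor.whiskerLeft (e ⋙ q) b.hom =
      Functor.whiskerRight a.hom f ≫ whiskerSquare p f q g α e)
    {Y : D.Dia I} {X : D.Dia J} (η : X ⟶ (D.res f).obj Y) :
    D.slideL α₁ η = (D.tr a.hom X ≫ (D.cmp e p X).hom) ≫ ((D.res e).map (D.slideL α η) ≫
      (D.cmp e q _).inv ≫ D.tr c.inv _) ≫ (D.res q₁).map (D.tr b.inv Y) := by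
  have h1 := resSquare_congr α₁ (whiskerSquare p f q g α e) a.hom (𝟙 f) c.hom b.hom
    (by simpa using h) Y
  rw [tr_id, CategoryTheory.Functor.map_id, Category.id_comp] at h1
  have h2 : (D.resSquare α₁).app Y = D.tr a.hom _ ≫
      (D.resSquare (whiskerSquare p f q g α e)).app Y ≫
        (D.res (e ⋙ q)).map (D.tr b.inv Y) ≫ D.tr c.inv _ := by
    rw [← reassoc_of% h1, ← Functor.map_comp_assoc, tr_comp, Iso.hom_inv_id, tr_id,
      CategoryTheory.Functor.map_id, Category.id_comp, tr_comp, Iso.hom_inv_id, tr_id,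
      Category.comp_id]
  have h3 := D.cmp_hom_naturality e p η
  simp only [slideL, Functor.map_comp, res_map_resSquare, Category.assoc, h2,
    Iso.hom_inv_id_assoc, ← D.tr_naturality c.inv, ← reassoc_of% h3]
  rw [← reassoc_of% D.tr_naturality a.hom]

end Paste

section Equivalence

variable {C C' C'' : Type*} [Category C] [Category C'] [Category C'']

lemma _root_.HEpi.IsCouniv.of_fullyFaithful {F : C ⥤ C'} {Y : C} {X : C'} {ε : F.obj Y ⟶ X}
    (h : IsCouniv F ε) (G : C' ⥤ C'') [G.Full] [G.Faithful] {F' : C ⥤ C''} (θ : F' ≅ F ⋙ G) :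
    IsCouniv F' (θ.hom.app Y ≫ G.map ε) := by
  intro Z
  have h1 := ((Functor.FullyFaithful.ofFullyFaithful G).homEquiv (X := F.obj Z)
    (Y := X)).bijective.comp (h Z)
  have h2 := (Iso.homFromEquiv (θ.app Z) (Z := G.obj X)).symm.bijective.comp h1
  convert h2 using 1
  ext g
  simp [Functor.FullyFaithful.homEquiv]

lemma _root_.HEpi.IsUniv.of_fullyFaithful {F : C ⥤ C'} {Y : C} {X : C'} {η : X ⟶ F.obj Y}
    (h : IsUniv F η) (G : C' ⥤ C'') [G.Full] [G.Faithful] {F' : C ⥤ C''} (θ : F' ≅ F ⋙ G) :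
    IsUniv F' (G.map η ≫ θ.inv.app Y) := by
  intro Z
  have h1 := ((Functor.FullyFaithful.ofFullyFaithful G).homEquiv (X := X)
    (Y := F.obj Z)).bijective.comp (h Z)
  have h2 := (Iso.homToEquiv (θ.app Z) (Z := G.obj X)).symm.bijective.comp h1
  convert h2 using 1
  ext g
  have := θ.inv.naturality g
  dsimp at this
  simp [Functor.FullyFaithful.homEquiv, this]

end Equivalence

section Transfer

variable {I J K L L' : Type w} [SmallCategory I] [SmallCategory J] [SmallCategory K]
  [SmallCategory L] [SmallCategory L'] {p : L ⥤ J} {f : J ⥤ I} {q : L ⥤ K} {g : K ⥤ I}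
  (α : p ⋙ f ⟶ q ⋙ g) (e : L' ⥤ L) [e.IsEquivalence]

/-- The isomorphism `p₁^* ≅ p^* ⋙ e^*` induced by `p₁ ≅ e ⋙ p`. -/
def resIsoComp {e : L' ⥤ L} {p₁ : L' ⥤ J} (a : p₁ ≅ e ⋙ p) : D.res p₁ ≅ D.res p ⋙ D.res e :=
  NatIso.ofComponents (fun S => D.trIso a S ≪≫ D.cmp e p S) (by
    intro X Y φ
    have h1 := D.tr_naturality a.hom φ
    have h2 := D.cmp_hom_naturality e p φ
    simp [reassoc_of% h1, h2])

/-- Restriction along an equivalence of the apex is fully faithful, so it preserves couniversality;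
the other changes are compositions with isomorphisms. -/
lemma isCouniv_slideR_of_equivalence {p₁ : L' ⥤ J} {f₁ : J ⥤ I} {q₁ : L' ⥤ K}
    (α₁ : p₁ ⋙ f₁ ⟶ q₁ ⋙ g) (a : p₁ ≅ e ⋙ p) (b : f₁ ≅ f) (c : q₁ ≅ e ⋙ q)
    (h : ∀ x, α₁.app x ≫ g.map (c.hom.app x) =
      f₁.map (a.hom.app x) ≫ b.hom.app (p.obj (e.obj x)) ≫ α.app (e.obj x))
    {Y : D.Dia I} {X : D.Dia K} {ε : (D.res g).obj Y ⟶ X}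
    (hε : IsCouniv (D.res p) (D.slideR α ε)) : IsCouniv (D.res p₁) (D.slideR α₁ ε) := by
  rw [slideR_of_equivalence α e α₁ a b c (by ext x; simp [h, whiskerSquare_app])]
  have h1 := (hε.of_fullyFaithful (D.res e) (resIsoComp a)).postcomp
    ((D.cmp e q X).inv ≫ D.tr c.inv X)
  have h2 := h1.precomp (D.tr b.hom Y)
  simpa [resIsoComp] using h2

lemma isUniv_slideL_of_equivalence {p₁ : L' ⥤ J} {g₁ : K ⥤ I} {q₁ : L' ⥤ K}
    (α₁ : p₁ ⋙ f ⟶ q₁ ⋙ g₁) (a : p₁ ≅ e ⋙ p) (b : g₁ ≅ g) (c : q₁ ≅ e ⋙ q)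
    (h : ∀ x, α₁.app x ≫ g₁.map (c.hom.app x) ≫ b.hom.app (q.obj (e.obj x)) =
      f.map (a.hom.app x) ≫ α.app (e.obj x))
    {Y : D.Dia I} {X : D.Dia J} {η : X ⟶ (D.res f).obj Y}
    (hη : IsUniv (D.res q) (D.slideL α η)) : IsUniv (D.res q₁) (D.slideL α₁ η) := by
  rw [slideL_of_equivalence α e α₁ a b c (by ext x; simpa [whiskerSquare_app] using h x)]
  have h1 := (hη.of_fullyFaithful (D.res e) (resIsoComp c)).precomp
    (D.tr a.hom X ≫ (D.cmp e p X).hom)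
  have h2 := h1.postcomp (D.tr b.inv Y)
  simpa [resIsoComp] using h2

end Transfer

end Prederivator

namespace Prederivator

variable {D : Prederivator.{w, v, u}}

/-! ### Shifts of derivators are derivators -/

section Shift

variable (A : Type w) [SmallCategory A]

section

variable {I J K L : Type w} [SmallCategory I] [SmallCategory J] [SmallCategory K]
  [SmallCategory L] {p : L ⥤ J} {f : J ⥤ I} {q : L ⥤ K} {g : K ⥤ I} (α : p ⋙ f ⟶ q ⋙ g)

/-- The product of a square with a category. -/
def prodSquare : (𝟭 A).prod p ⋙ (𝟭 A).prod f ⟶ (𝟭 A).prod q ⋙ (𝟭 A).prod g where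
  app x := (𝟙 x.1, α.app x.2)
  naturality _ _ φ := Prod.hom_ext ((Category.comp_id φ.1).trans (Category.id_comp φ.1).symm)
    (α.naturality φ.2)

/-- The coherence map of a composite 2-functor has an extra factor, which here is the image of an
identity 2-cell. -/
lemma shift_cmp_hom (X : D.Dia (A × I)) :
    ((D.shift A).cmp p f X).hom = (D.cmp ((𝟭 A).prod p) ((𝟭 A).prod f) X).hom := by
  refine Eq.trans ?_ (Category.id_comp _)
  exact congr($(D.tr_id ((𝟭 A).prod p ⋙ (𝟭 A).prod f) X) ≫ _)

lemma shift_cmp_inv (X : D.Dia (A × I)) :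
    ((D.shift A).cmp p f X).inv = (D.cmp ((𝟭 A).prod p) ((𝟭 A).prod f) X).inv := by
  refine Eq.trans ?_ (Category.comp_id _)
  exact congr(_ ≫ $(D.tr_id ((𝟭 A).prod p ⋙ (𝟭 A).prod f) X))

lemma shift_resSquare_app (Y : D.Dia (A × I)) :
    ((D.shift A).resSquare α).app Y = (D.resSquare (prodSquare A α)).app Y := by
  refine ((D.shift A).resSquare_app α Y).trans ?_
  rw [shift_cmp_hom, shift_cmp_inv]
  rfl

lemma shift_slideR {Y : D.Dia (A × I)} {X : D.Dia (A × K)}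
    (ε : (D.res ((𝟭 A).prod g)).obj Y ⟶ X) :
    (D.shift A).slideR α ε = D.slideR (prodSquare A α) ε :=
  congr($(shift_resSquare_app A α Y) ≫ _)

lemma shift_slideL {Y : D.Dia (A × I)} {X : D.Dia (A × J)}
    (η : X ⟶ (D.res ((𝟭 A).prod f)).obj Y) :
    (D.shift A).slideL α η = D.slideL (prodSquare A α) η :=
  congr(_ ≫ $(shift_resSquare_app A α Y))

end

section

variable {S : Type w} (J : S → Type w) [∀ k, SmallCategory (J k)]

/-- Products distribute over disjoint unions. -/
abbrev sigmaProd : (Σ k, A × J k) ⥤ A × (Σ k, J k) :=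
  Sigma.desc fun k => (𝟭 A).prod (Sigma.incl k)

instance : (sigmaProd A J).IsEquivalence where
  faithful := ⟨by
    rintro _ _ ⟨f⟩ f' h
    obtain ⟨f', rfl⟩ := (Sigma.incl (C := fun k => A × J k) _).map_surjective f'
    have h1 := congr(($h).1)
    have h2 := (Sigma.incl (C := J) _).map_injective congr(($h).2)
    exact congrArg _ (Prod.hom_ext h1 h2)⟩
  full := ⟨by
    rintro ⟨k, a, x⟩ ⟨l, b, y⟩ ⟨g, f⟩
    obtain ⟨f⟩ := f
    exact ⟨(Sigma.incl (C := fun k => A × J k) _).map (g, f), rfl⟩⟩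
  essSurj := ⟨fun ⟨a, ⟨k, x⟩⟩ => ⟨⟨k, (a, x)⟩, ⟨Iso.refl _⟩⟩⟩

end

section

variable {I J : Type w} [SmallCategory I] [SmallCategory J] (f : I ⥤ J) (a : A) (j : J)

/-- The slices of `A × (j / f) ⥤ A`. -/
def structuredArrowProd :
    StructuredArrow (a, (Discrete.mk PUnit.unit : Pt.{w}))
      ((𝟭 A).prod (toPt (StructuredArrow j f))) ⥤
    StructuredArrow (a, j) ((𝟭 A).prod f) where
  obj y := StructuredArrow.mk (Y := (y.right.1, y.right.2.right))
    ((y.hom.1, y.right.2.hom) : (a, j) ⟶ (y.right.1, f.obj y.right.2.right))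
  map g := StructuredArrow.homMk (g.right.1, g.right.2.right)
    (Prod.hom_ext congr(($(StructuredArrow.w g)).1) (StructuredArrow.w g.right.2))
  map_id _ := rfl
  map_comp _ _ := rfl

instance : (structuredArrowProd A f a j).IsEquivalence where
  faithful := ⟨fun e => StructuredArrow.hom_ext _ _
    (Prod.hom_ext congr(($e).right.1) (StructuredArrow.hom_ext _ _ congr(($e).right.2)))⟩
  full := ⟨fun g => ⟨StructuredArrow.homMk
    (g.right.1, StructuredArrow.homMk g.right.2 congr(($(StructuredArrow.w g)).2))
    (Prod.hom_ext congr(($(StructuredArrow.w g)).1) (Subsingleton.elim _ _)), rfl⟩⟩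
  essSurj := ⟨fun y => ⟨StructuredArrow.mk (Y := (y.right.1, StructuredArrow.mk y.hom.2))
    (y.hom.1, 𝟙 _), ⟨Iso.refl _⟩⟩⟩

/-- The slices of `A × (f / j) ⥤ A`. -/
def costructuredArrowProd :
    CostructuredArrow ((𝟭 A).prod (toPt (CostructuredArrow f j)))
      (a, (Discrete.mk PUnit.unit : Pt.{w})) ⥤
    CostructuredArrow ((𝟭 A).prod f) (a, j) where
  obj y := CostructuredArrow.mk (Y := (y.left.1, y.left.2.left))
    ((y.hom.1, y.left.2.hom) : (y.left.1, f.obj y.left.2.left) ⟶ (a, j))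
  map g := CostructuredArrow.homMk (g.left.1, g.left.2.left)
    (Prod.hom_ext congr(($(CostructuredArrow.w g)).1) (CostructuredArrow.w g.left.2))
  map_id _ := rfl
  map_comp _ _ := rfl

instance : (costructuredArrowProd A f a j).IsEquivalence where
  faithful := ⟨fun e => CostructuredArrow.hom_ext _ _
    (Prod.hom_ext congr(($e).left.1) (CostructuredArrow.hom_ext _ _ congr(($e).left.2)))⟩
  full := ⟨fun g => ⟨CostructuredArrow.homMk
    (g.left.1, CostructuredArrow.homMk g.left.2 congr(($(CostructuredArrow.w g)).2))
    (Prod.hom_ext congr(($(CostructuredArrow.w g)).1) (Subsingleton.elim _ _)), rfl⟩⟩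
  essSurj := ⟨fun y => ⟨CostructuredArrow.mk (Y := (y.left.1, CostructuredArrow.mk y.hom.2))
    (y.hom.1, 𝟙 _), ⟨Iso.refl _⟩⟩⟩

end

namespace IsDerivator

variable (hD : D.IsDerivator)
include hD

section

variable {I J : Type w} [SmallCategory I] [SmallCategory J] (f : I ⥤ J) (j : J)

/-- The product of `A` with a slice square is not a slice square. Universality is tested on the
slices of `A × (f / j) ⥤ A × 𝟏`; there the pasted square is equivalent to the slice square of `A ×
f` at `(a, j)`. -/
lemma isUniv_slideL_prodSquare {X : D.Dia (A × I)} {Y : D.Dia (A × J)}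
    {η : X ⟶ (D.res ((𝟭 A).prod f)).obj Y} (hη : IsUniv (D.res ((𝟭 A).prod f)) η) :
    IsUniv (D.res ((𝟭 A).prod (toPt (CostructuredArrow f j))))
      (D.slideL (prodSquare A (sliceLeft f j)) η) := by
  refine hD.isUniv_of_slices ((𝟭 A).prod (toPt _)) _ ?_
  rintro ⟨a, ⟨⟨⟩⟩⟩
  rw [slideL_slideL]
  refine (IsUniv.postcomp ?_ (D.cmp _ _ Y).hom).precomp (D.cmp _ _ X).inv
  refine isUniv_slideL_of_equivalence (sliceLeft ((𝟭 A).prod f) (a, j))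
    (costructuredArrowProd A f a j) _ (Iso.refl _)
    (pickComp (I := A × Pt.{w}) (a, ⟨⟨⟩⟩) ((𝟭 A).prod (pick j))) (Iso.refl _) ?_
    (hD.isUniv_slideL ((𝟭 A).prod f) (a, j) hη)
  intro x
  rw [pasteLeft_app]
  refine Prod.hom_ext ?_ ?_
  · change (𝟙 _ ≫ x.hom.1) ≫ 𝟙 _ ≫ 𝟙 _ = 𝟙 _ ≫ x.hom.1
    simp
  · change (x.left.2.hom ≫ 𝟙 _) ≫ 𝟙 _ ≫ 𝟙 _ = f.map (𝟙 _) ≫ x.left.2.hom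
    simp

lemma isCouniv_slideR_prodSquare {X : D.Dia (A × I)} {Y : D.Dia (A × J)}
    {ε : (D.res ((𝟭 A).prod f)).obj Y ⟶ X} (hε : IsCouniv (D.res ((𝟭 A).prod f)) ε) :
    IsCouniv (D.res ((𝟭 A).prod (toPt (StructuredArrow j f))))
      (D.slideR (prodSquare A (sliceRight f j)) ε) := by
  refine hD.isCouniv_of_slices ((𝟭 A).prod (toPt _)) _ ?_
  rintro ⟨a, ⟨⟨⟩⟩⟩
  rw [slideR_slideR]
  refine (IsCouniv.postcomp ?_ (D.cmp _ _ X).hom).precomp (D.cmp _ _ Y).inv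
  refine isCouniv_slideR_of_equivalence (sliceRight ((𝟭 A).prod f) (a, j))
    (structuredArrowProd A f a j) _ (Iso.refl _)
    (pickComp (I := A × Pt.{w}) (a, ⟨⟨⟩⟩) ((𝟭 A).prod (pick j))) (Iso.refl _) ?_
    (hD.isCouniv_slideR ((𝟭 A).prod f) (a, j) hε)
  intro x
  rw [pasteRight_app]
  refine Prod.hom_ext ?_ ?_
  · change (x.hom.1 ≫ 𝟙 _) ≫ 𝟙 _ = 𝟙 _ ≫ 𝟙 _ ≫ x.hom.1
    simp
  · change (𝟙 _ ≫ x.right.2.hom) ≫ f.map (𝟙 _) = 𝟙 _ ≫ 𝟙 _ ≫ x.right.2.hom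
    simp

lemma isIso_iff_prod_pick {X Y : D.Dia (A × I)} (φ : X ⟶ Y) :
    IsIso φ ↔ ∀ i : I, IsIso ((D.res ((𝟭 A).prod (pick i))).map φ) := by
  refine ⟨fun _ i => inferInstance, fun h => (hD.der2 φ).2 fun x => ?_⟩
  have := h x.2
  have h' := isIso_pick_map_iff (K := A × Pt.{w}) (x.1, ⟨⟨⟩⟩) ((𝟭 A).prod (pick x.2)) φ
  exact h'.2 ((D.res _).map_isIso _)

end

lemma isEquivalence_pi_res_prod {S : Type w} (J : S → Type w) [∀ k, SmallCategory (J k)] :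
    (Functor.pi' fun k => D.res ((𝟭 A).prod (Sigma.incl (C := J) k))).IsEquivalence := by
  have := hD.der1 fun k => A × J k
  refine Functor.isEquivalence_of_iso (F := D.res (sigmaProd A J) ⋙ D.toProd fun k => A × J k)
    (NatIso.pi' fun k => ?_)
  exact (D.resComp (Sigma.incl k) (sigmaProd A J)).symm

lemma shift : (D.shift A).IsDerivator :=
  IsDerivator.of_universal _ (hD.isEquivalence_pi_res_prod A) (hD.isIso_iff_prod_pick A)
    (fun f X => hD.exists_isUniv ((𝟭 A).prod f) X)
    (fun f X => hD.exists_isCouniv ((𝟭 A).prod f) X)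
    (fun f j _ _ η hη => congr(IsUniv _ $(shift_slideL A (sliceLeft f j) η)).mpr
      (hD.isUniv_slideL_prodSquare A f j hη))
    (fun f j _ _ ε hε => congr(IsCouniv _ $(shift_slideR A (sliceRight f j) ε)).mpr
      (hD.isCouniv_slideR_prodSquare A f j hε))

end IsDerivator

end Shift

end Prederivator

/-! ### Transport of universal arrows along equivalences -/

section Universal

variable {C C' E E' : Type*} [Category C] [Category C'] [Category E] [Category E']
  {F : C ⥤ C'} {F₂ : E ⥤ E'} {Φ : C ⥤ E} {Φ' : C' ⥤ E'}

lemma isCouniv_precomp_iff {X : C'} {Y Y' : C} (ε : F.obj Y ⟶ X) (k : Y' ⟶ Y) [IsIso k] :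
    IsCouniv F (F.map k ≫ ε) ↔ IsCouniv F ε :=
  ⟨fun h => by simpa using h.precomp (inv k), fun h => h.precomp k⟩

lemma isUniv_postcomp_iff {X : C'} {Y Y' : C} (η : X ⟶ F.obj Y) (k : Y ⟶ Y') [IsIso k] :
    IsUniv F (η ≫ F.map k) ↔ IsUniv F η :=
  ⟨fun h => by simpa using h.postcomp (inv k), fun h => h.postcomp k⟩

lemma isCouniv_postcomp_iff {X X' : C'} {Y : C} (ε : F.obj Y ⟶ X) (k : X ⟶ X') [IsIso k] :
    IsCouniv F (ε ≫ k) ↔ IsCouniv F ε :=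
  ⟨fun h => by simpa using h.postcomp (inv k), fun h => h.postcomp k⟩

lemma isUniv_precomp_iff {X X' : C'} {Y : C} (η : X ⟶ F.obj Y) (k : X' ⟶ X) [IsIso k] :
    IsUniv F (k ≫ η) ↔ IsUniv F η :=
  ⟨fun h => by simpa using h.precomp (inv k), fun h => h.precomp k⟩

lemma isCouniv_comp_iff [Φ.IsEquivalence] {X : E'} {Y : C} (ε : F₂.obj (Φ.obj Y) ⟶ X) :
    IsCouniv (Φ ⋙ F₂) ε ↔ IsCouniv F₂ ε := by
  have key (Z : C) : (fun g : Z ⟶ Y => (Φ ⋙ F₂).map g ≫ ε) =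
      (fun g : Φ.obj Z ⟶ Φ.obj Y => F₂.map g ≫ ε) ∘ Functor.FullyFaithful.homEquiv
        (Functor.FullyFaithful.ofFullyFaithful Φ) := rfl
  refine ⟨fun h Z => ?_, fun h Z => ?_⟩
  · let e := Φ.objObjPreimageIso Z
    have h1 := h (Φ.objPreimage Z)
    rw [key, Equiv.bijective_comp] at h1
    have h2 := (Iso.homFromEquiv (F₂.mapIso e)).bijective.comp
      (h1.comp (Iso.homFromEquiv e (Z := Φ.obj Y)).symm.bijective)
    convert h2 using 1
    ext g
    simp
  · rw [key, Equiv.bijective_comp]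
    exact h _

lemma isUniv_comp_iff [Φ.IsEquivalence] {X : E'} {Y : C} (η : X ⟶ F₂.obj (Φ.obj Y)) :
    IsUniv (Φ ⋙ F₂) η ↔ IsUniv F₂ η := by
  have key (Z : C) : (fun g : Y ⟶ Z => η ≫ (Φ ⋙ F₂).map g) =
      (fun g : Φ.obj Y ⟶ Φ.obj Z => η ≫ F₂.map g) ∘ Functor.FullyFaithful.homEquiv
        (Functor.FullyFaithful.ofFullyFaithful Φ) := rfl
  refine ⟨fun h Z => ?_, fun h Z => ?_⟩
  · let e := Φ.objObjPreimageIso Z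
    have h1 := h (Φ.objPreimage Z)
    rw [key, Equiv.bijective_comp] at h1
    have h2 := (Iso.homToEquiv (F₂.mapIso e)).bijective.comp
      (h1.comp (Iso.homToEquiv e (Z := Φ.obj Y)).symm.bijective)
    convert h2 using 1
    ext g
    simp
  · rw [key, Equiv.bijective_comp]
    exact h _

/-- Since `Φ` is an equivalence, test objects may be taken in its image; full faithfulness of `Φ'`
then identifies the two bijections. -/
lemma isCouniv_iff_of_square [Φ.IsEquivalence] [Φ'.Full] [Φ'.Faithful] (θ : F ⋙ Φ' ≅ Φ ⋙ F₂)
    {X : C'} {Y : C} (ε : F.obj Y ⟶ X) :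
    IsCouniv F₂ (θ.inv.app Y ≫ Φ'.map ε) ↔ IsCouniv F ε := by
  rw [← isCouniv_comp_iff (Φ := Φ)]
  refine ⟨fun h Z => ?_, fun h => h.of_fullyFaithful Φ' θ.symm⟩
  have key (g : Z ⟶ Y) : (Φ ⋙ F₂).map g ≫ θ.inv.app Y ≫ Φ'.map ε =
      θ.inv.app Z ≫ Φ'.map (F.map g ≫ ε) := by
    rw [Functor.map_comp]
    exact θ.inv.naturality_assoc g _
  refine ⟨fun g g' hg => (h Z).1 ?_, fun k => ?_⟩
  · dsimp only at hg ⊢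
    rw [key, key, hg]
  · obtain ⟨g, hg⟩ := (h Z).2 (θ.inv.app Z ≫ Φ'.map k)
    refine ⟨g, Φ'.map_injective ?_⟩
    dsimp only at hg ⊢
    rwa [key, cancel_epi] at hg

lemma isUniv_iff_of_square [Φ.IsEquivalence] [Φ'.Full] [Φ'.Faithful] (θ : F ⋙ Φ' ≅ Φ ⋙ F₂)
    {X : C'} {Y : C} (η : X ⟶ F.obj Y) :
    IsUniv F₂ (Φ'.map η ≫ θ.hom.app Y) ↔ IsUniv F η := by
  rw [← isUniv_comp_iff (Φ := Φ)]
  refine ⟨fun h Z => ?_, fun h => h.of_fullyFaithful Φ' θ.symm⟩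
  have key (g : Y ⟶ Z) : (Φ'.map η ≫ θ.hom.app Y) ≫ (Φ ⋙ F₂).map g =
      Φ'.map (η ≫ F.map g) ≫ θ.hom.app Z := by
    rw [Functor.map_comp, Category.assoc, Category.assoc]
    exact congrArg (_ ≫ ·) (θ.hom.naturality g).symm
  refine ⟨fun g g' hg => (h Z).1 ?_, fun k => ?_⟩
  · dsimp only at hg ⊢
    rw [key, key, hg]
  · obtain ⟨g, hg⟩ := (h Z).2 (Φ'.map k ≫ θ.hom.app Z)
    refine ⟨g, Φ'.map_injective ?_⟩
    dsimp only at hg ⊢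
    rwa [key, cancel_mono] at hg

end Universal

/-! ### Invariance of the axioms under equivalence -/

namespace Prederivator

/-- An equivalence of prederivators. -/
structure DiaEquiv (P Q : Prederivator.{w, v, u}) where
  /-- The underlying functors. -/
  functor (J : Type w) [SmallCategory J] : P.Dia J ⥤ Q.Dia J
  /-- The underlying functors are equivalences. -/
  isEquivalence (J : Type w) [SmallCategory J] : (functor J).IsEquivalence
  /-- Compatibility with restriction functors. -/
  resIso {J K : Type w} [SmallCategory J] [SmallCategory K] (f : K ⥤ J) :
    P.res f ⋙ functor K ≅ functor J ⋙ Q.res f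
  /-- Compatibility with the maps induced by squares. -/
  map_resSquare {I J K L : Type w} [SmallCategory I] [SmallCategory J] [SmallCategory K]
    [SmallCategory L] {p : L ⥤ J} {f : J ⥤ I} {q : L ⥤ K} {g : K ⥤ I} (α : p ⋙ f ⟶ q ⋙ g)
    (Y : P.Dia I) :
    (functor L).map ((P.resSquare α).app Y) ≫ (resIso q).hom.app _ ≫
      (Q.res q).map ((resIso g).hom.app Y) =
    (resIso p).hom.app _ ≫ (Q.res p).map ((resIso f).hom.app Y) ≫ (Q.resSquare α).app _

namespace DiaEquiv

variable {P Q : Prederivator.{w, v, u}} (e : DiaEquiv P Q)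

attribute [instance] isEquivalence

section

variable {I J K L : Type w} [SmallCategory I] [SmallCategory J] [SmallCategory K]
  [SmallCategory L] {p : L ⥤ J} {f : J ⥤ I} {q : L ⥤ K} {g : K ⥤ I} (α : p ⋙ f ⟶ q ⋙ g)

lemma inv_comp_map_resSquare (Y : P.Dia I) :
    (e.resIso p).inv.app _ ≫ (e.functor L).map ((P.resSquare α).app Y) =
      (Q.res p).map ((e.resIso f).hom.app Y) ≫ (Q.resSquare α).app _ ≫
        (Q.res q).map ((e.resIso g).inv.app Y) ≫ (e.resIso q).inv.app _ := by
  have h1 := (e.resIso p).inv.app _ ≫= e.map_resSquare α Y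
  rw [Iso.inv_hom_id_app_assoc] at h1
  have h2 : (Q.res q).map ((e.resIso g).hom.app Y) ≫ (Q.res q).map ((e.resIso g).inv.app Y) ≫
      (e.resIso q).inv.app _ = (e.resIso q).inv.app _ :=
    ((Q.res q).mapIso ((e.resIso g).app Y)).hom_inv_id_assoc _
  rw [← reassoc_of% h1, h2, Iso.hom_inv_id_app]
  exact congrArg (_ ≫ ·) (Category.comp_id _).symm

lemma slideR_map {Y : P.Dia I} {X : P.Dia K} (ε : (P.res g).obj Y ⟶ X) :
    (e.resIso p).inv.app _ ≫ (e.functor L).map (P.slideR α ε) =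
      (Q.res p).map ((e.resIso f).hom.app Y) ≫
        Q.slideR α ((e.resIso g).inv.app Y ≫ (e.functor K).map ε) ≫ (e.resIso q).inv.app X := by
  have h2 : (Q.res q).map ((e.functor K).map ε) ≫ (e.resIso q).inv.app X =
      (e.resIso q).inv.app _ ≫ (e.functor L).map ((P.res q).map ε) :=
    (e.resIso q).inv.naturality ε
  rw [slideR, slideR, (e.functor L).map_comp, reassoc_of% e.inv_comp_map_resSquare α Y,
    (Q.res q).map_comp]
  simp only [Category.assoc, h2]

lemma slideL_map {Y : P.Dia I} {X : P.Dia J} (η : X ⟶ (P.res f).obj Y) :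
    (e.functor L).map (P.slideL α η) ≫ (e.resIso q).hom.app _ =
      (e.resIso p).hom.app X ≫ Q.slideL α ((e.functor J).map η ≫ (e.resIso f).hom.app Y) ≫
        (Q.res q).map ((e.resIso g).inv.app Y) := by
  have h2 : (e.functor L).map ((P.res p).map η) ≫ (e.resIso p).hom.app _ =
      (e.resIso p).hom.app _ ≫ (Q.res p).map ((e.functor J).map η) :=
    (e.resIso p).hom.naturality η
  have h3 := (e.resIso p).hom.app _ ≫= (e.inv_comp_map_resSquare α Y =≫ (e.resIso q).hom.app _)
  rw [Category.assoc, Iso.hom_inv_id_app_assoc] at h3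
  rw [slideL, slideL, (e.functor L).map_comp, Category.assoc, h3, (Q.res p).map_comp]
  simp only [Category.assoc, Iso.inv_hom_id_app]
  rw [reassoc_of% h2]
  simp

end

include e in
theorem isDerivator (hP : P.IsDerivator) : Q.IsDerivator := by
  refine IsDerivator.of_universal _ ?_ ?_ ?_ ?_ ?_ ?_
  · intro S J _
    have := hP.der1 J
    have : (Functor.pi fun k => e.functor (J k)).IsEquivalence :=
      (CategoryTheory.Equivalence.pi fun k =>
        (e.functor (J k)).asEquivalence).isEquivalence_functor
    let θ : P.toProd J ⋙ (Functor.pi fun k => e.functor (J k)) ≅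
        e.functor (Σ k, J k) ⋙ Q.toProd J :=
      NatIso.pi' fun k => e.resIso (Sigma.incl k)
    have := Functor.isEquivalence_of_iso θ
    -- The other three sides of the square `θ` are equivalences.
    exact Functor.isEquivalence_of_comp_left (e.functor (Σ k, J k)) (Q.toProd J)
  · intro I _ X Y φ
    refine ⟨fun _ i => inferInstance, fun h => ?_⟩
    let eX := (e.functor I).objObjPreimageIso X
    let eY := (e.functor I).objObjPreimageIso Y
    let ψ := (e.functor I).preimage (eX.hom ≫ φ ≫ eY.inv)
    have hψ : φ = eX.inv ≫ (e.functor I).map ψ ≫ eY.hom := by simp [ψ]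
    have : IsIso ψ := (hP.der2 ψ).2 fun i => by
      have := h i
      rw [← isIso_iff_of_reflects_iso _ (e.functor Pt)]
      have h1 : IsIso ((e.functor I ⋙ Q.res (pick i)).map ψ) := by
        simp [ψ]
        infer_instance
      exact (NatIso.isIso_map_iff (e.resIso (pick i)) ψ).2 h1
    rw [hψ]
    infer_instance
  · intro I J _ _ f X
    obtain ⟨Y, η, hη⟩ := hP.exists_isUniv f ((e.functor I).objPreimage X)
    exact ⟨_, _, ((isUniv_iff_of_square (e.resIso f) η).2 hη).precomp
      ((e.functor I).objObjPreimageIso X).inv⟩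
  · intro I J _ _ f X
    obtain ⟨Y, ε, hε⟩ := hP.exists_isCouniv f ((e.functor I).objPreimage X)
    exact ⟨_, _, ((isCouniv_iff_of_square (e.resIso f) ε).2 hε).postcomp
      ((e.functor I).objObjPreimageIso X).hom⟩
  · intro I J _ _ f j X Y η hη
    let eX := (e.functor I).objObjPreimageIso X
    let eY := (e.functor J).objObjPreimageIso Y
    -- The given arrow is lifted to `P` up to isomorphisms of source and target; these are stripped
    -- off again once the pointwise axiom has been applied in `P`.
    obtain ⟨η', hη'⟩ := (e.functor I).map_surjective
      (eX.hom ≫ η ≫ (Q.res f).map eY.inv ≫ (e.resIso f).inv.app _)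
    have h1 : (e.functor I).map η' ≫ (e.resIso f).hom.app _ =
        eX.hom ≫ η ≫ (Q.res f).map eY.inv := by
      simp [hη']
    have h2 : IsUniv (P.res f) η' := by
      rw [← isUniv_iff_of_square (e.resIso f), h1, isUniv_precomp_iff, isUniv_postcomp_iff]
      exact hη
    have h3 := hP.isUniv_slideL f j h2
    rw [← isUniv_iff_of_square (e.resIso _), slideL_map, h1, slideL_precomp, slideL_postcomp,
      isUniv_precomp_iff, isUniv_postcomp_iff, isUniv_precomp_iff, isUniv_postcomp_iff] at h3
    exact h3
  · intro I J _ _ f j X Y ε hε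
    let eX := (e.functor I).objObjPreimageIso X
    let eY := (e.functor J).objObjPreimageIso Y
    obtain ⟨ε', hε'⟩ := (e.functor I).map_surjective
      ((e.resIso f).hom.app _ ≫ (Q.res f).map eY.hom ≫ ε ≫ eX.inv)
    have h1 : (e.resIso f).inv.app _ ≫ (e.functor I).map ε' =
        (Q.res f).map eY.hom ≫ ε ≫ eX.inv := by
      simp [hε']
    have h2 : IsCouniv (P.res f) ε' := by
      rw [← isCouniv_iff_of_square (e.resIso f), h1, isCouniv_precomp_iff, isCouniv_postcomp_iff]
      exact hε
    have h3 := hP.isCouniv_slideR f j h2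
    rw [← isCouniv_iff_of_square (e.resIso _), slideR_map, h1, slideR_precomp, slideR_postcomp,
      isCouniv_precomp_iff, isCouniv_postcomp_iff, isCouniv_precomp_iff,
      isCouniv_postcomp_iff] at h3
    exact h3

end DiaEquiv

end Prederivator

/-! ### Compatibility of `u^*` with 2-cells, and of 2-cells with full sub-prederivators -/

namespace Prederivator

variable {D : Prederivator.{w, v, u}}

section Cube

variable {I J K L I' J' K' L' : Type w} [SmallCategory I] [SmallCategory J] [SmallCategory K]
  [SmallCategory L] [SmallCategory I'] [SmallCategory J'] [SmallCategory K'] [SmallCategory L']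
  {p : L ⥤ J} {f : J ⥤ I} {q : L ⥤ K} {g : K ⥤ I} (α : p ⋙ f ⟶ q ⋙ g)
  {p' : L' ⥤ J'} {f' : J' ⥤ I'} {q' : L' ⥤ K'} {g' : K' ⥤ I'} (α' : p' ⋙ f' ⟶ q' ⋙ g')
  {uI : I' ⥤ I} {uJ : J' ⥤ J} {uK : K' ⥤ K} {uL : L' ⥤ L}

/-- A commutative cube of 2-cells induces a commutative cube of restriction functors. -/
lemma resSquare_cube (sp : uL ⋙ p ⟶ p' ⋙ uJ) (sf : uJ ⋙ f ⟶ f' ⋙ uI) (sq : uL ⋙ q ⟶ q' ⋙ uK)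
    (sg : uK ⋙ g ⟶ g' ⋙ uI)
    (h : pasteRight sf sp ≫ Functor.whiskerRight α' uI =
      Functor.whiskerLeft uL α ≫ pasteRight sg sq) (Y : D.Dia I) :
    (D.res uL).map ((D.resSquare α).app Y) ≫ (D.resSquare sq).app _ ≫
      (D.res q').map ((D.resSquare sg).app Y) =
    (D.resSquare sp).app _ ≫ (D.res p').map ((D.resSquare sf).app Y) ≫
      (D.resSquare α').app ((D.res uI).obj Y) := by
  have h1 := resSquare_congr (D := D) (pasteRight sf sp) (pasteRight sg sq) (𝟙 uL) α α' (𝟙 uI)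
    (by simpa using h) Y
  simp only [tr_id, CategoryTheory.Functor.map_id, Category.comp_id, Category.id_comp] at h1
  have h2 : (D.res uL).map (D.cmp q g Y).hom ≫ (D.res uL).map (D.cmp q g Y).inv = 𝟙 _ :=
    ((D.res uL).mapIso (D.cmp q g Y)).hom_inv_id
  rw [resSquare_pasteRight, reassoc_of% resSquare_pasteRight sf sp Y, resSquare_app _ α,
    resSquare_app _ α', Iso.hom_inv_id_assoc, reassoc_of% h1]
  simp only [Functor.map_comp, Category.assoc, reassoc_of% h2]

end Cube

section FullSub

variable {E : ∀ (J : Type w) [SmallCategory J], ObjectProperty (D.Dia J)}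
    {hE : ∀ {J K : Type w} [SmallCategory J] [SmallCategory K] (f : K ⥤ J) (X : D.Dia J),
      E J X → E K ((D.res f).obj X)}
variable {I J K L : Type w} [SmallCategory I] [SmallCategory J] [SmallCategory K]
  [SmallCategory L] {p : L ⥤ J} {f : J ⥤ I} {q : L ⥤ K} {g : K ⥤ I} (α : p ⋙ f ⟶ q ⋙ g)

/-- The coherence maps on both sides are `eqToHom`s, and the inclusion of the full subcategory
matches them. -/
lemma fullSub_resSquare_app (X : (E I).FullSubcategory) :
    (((D.fullSub E hE).resSquare α).app X).hom = (D.resSquare α).app X.obj := by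
  refine Eq.symm (congrArg₂ (· ≫ ·) ?_ (congrArg₂ (· ≫ ·) rfl ?_))
  · exact ((mapComp_inv_app D _ _ X.obj).trans (eq_of_heq (fullSub_eqToHom_app
      ((D.fullSub E hE).map_comp f.toCatHom.op p.toCatHom.op).symm _ X X.obj rfl rfl))).trans
      congr(($(mapComp_inv_app (D.fullSub E hE) f.toCatHom.op p.toCatHom.op X)).hom).symm
  · exact ((mapComp_hom_app D _ _ X.obj).trans (eq_of_heq (fullSub_eqToHom_app
      ((D.fullSub E hE).map_comp g.toCatHom.op q.toCatHom.op) _ X X.obj rfl rfl))).trans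
      congr(($(mapComp_hom_app (D.fullSub E hE) g.toCatHom.op q.toCatHom.op X)).hom).symm

end FullSub

section ShiftRes

variable {A B I J K L : Type w} [SmallCategory A] [SmallCategory B]
  [SmallCategory I] [SmallCategory J] [SmallCategory K] [SmallCategory L]

/-- The commutative square underlying `shiftResComm`. -/
def prodComm (u : A ⥤ B) (f : K ⥤ J) :
    u.prod (𝟭 K) ⋙ (𝟭 B).prod f ⟶ (𝟭 A).prod f ⋙ u.prod (𝟭 J) :=
  𝟙 (u.prod f)

lemma prodComm_app (u : A ⥤ B) (f : K ⥤ J) (x : A × K) :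
    (prodComm u f).app x = 𝟙 ((u.prod f).obj x) := rfl

lemma shiftResComm_hom_app (u : A ⥤ B) (f : K ⥤ J) (Y : D.Dia (B × J)) :
    (D.shiftResComm u f).hom.app Y = (D.resSquare (prodComm u f)).app Y := by
  rw [resSquare_app]
  exact congr(_ ≫ $((Category.id_comp _).symm.trans
    congr($((D.tr_id (u.prod f) Y).symm) ≫ _)))

/-- This is the cube whose faces are `B × α`, `A × α` and four identity squares; it commutes because
`u` and `α` act on different factors. -/
lemma shiftRes_map_resSquare (u : A ⥤ B) {p : L ⥤ J} {f : J ⥤ I} {q : L ⥤ K} {g : K ⥤ I}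
    (α : p ⋙ f ⟶ q ⋙ g) (Y : (D.shift B).Dia I) :
    (D.shiftRes u L).map (((D.shift B).resSquare α).app Y) ≫ (D.shiftResComm u q).hom.app _ ≫
      ((D.shift A).res q).map ((D.shiftResComm u g).hom.app Y) =
    (D.shiftResComm u p).hom.app _ ≫ ((D.shift A).res p).map ((D.shiftResComm u f).hom.app Y) ≫
      ((D.shift A).resSquare α).app _ := by
  refine Eq.trans ?_ ((resSquare_cube (D := D) (prodSquare B α) (prodSquare A α)
    (prodComm u p) (prodComm u f) (prodComm u q) (prodComm u g) ?_ Y).trans ?_)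
  · exact congr((D.res _).map $(shift_resSquare_app B α Y) ≫ $(shiftResComm_hom_app u q _) ≫
      (D.res _).map $(shiftResComm_hom_app u g Y))
  · refine NatTrans.ext (funext fun x => ?_)
    rw [NatTrans.comp_app, NatTrans.comp_app, Functor.whiskerRight_app, Functor.whiskerLeft_app,
      pasteRight_app, pasteRight_app, prodComm_app, prodComm_app, prodComm_app, prodComm_app]
    refine Prod.hom_ext ?_ ?_
    · dsimp [prodSquare]
      simp
    · dsimp [prodSquare]
      simp
  · exact congr($((shiftResComm_hom_app u p _).symm) ≫
      (D.res _).map $((shiftResComm_hom_app u f Y).symm) ≫ $((shift_resSquare_app A α _).symm))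

end ShiftRes

end Prederivator

/-! ### The equivalence of `𝔻^I` with the fibrewise constant diagrams -/

section

variable (I : Type w) [SmallCategory I] {D : Prederivator.{w, v, u}}

open Prederivator

variable {I} in
/-- A functor `f` is a homotopical epimorphism as soon as `f^* : 𝔻^I ⟶ 𝔻^J` is fully faithful
at the terminal category. -/
lemma full_faithful_res_of_shiftRes {A : Type w} [SmallCategory A] (u : A ⥤ I)
    [(D.res (u.prod (𝟭 Pt))).Full] [(D.res (u.prod (𝟭 Pt))).Faithful] :
    (D.res u).Full ∧ (D.res u).Faithful := by
  have := (prod.rightUnitorEquivalence A).isEquivalence_inverse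
  have : (D.res (prod.rightInverseUnitor A)).IsEquivalence :=
    res_isEquivalence (prod.rightUnitorEquivalence A).inverse
  -- Up to the equivalences `A ≌ A × 𝟏` and `I × 𝟏 ≌ I`, the functor `u` is `u × 𝟏`.
  let e : D.res u ≅ D.res (prod.rightUnitor I) ⋙ D.res (u.prod (𝟭 Pt)) ⋙
      D.res (prod.rightInverseUnitor A) :=
    D.resComp (prod.rightInverseUnitor A ⋙ u.prod (𝟭 Pt)) (prod.rightUnitor I) ≪≫
      Functor.isoWhiskerLeft _ (D.resComp (prod.rightInverseUnitor A) (u.prod (𝟭 Pt)))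
  exact ⟨Functor.Full.of_iso e.symm, Functor.Faithful.of_iso e.symm⟩

/-- The equivalence between `𝔻^I` and the diagrams that are constant on the fibres. -/
def equivFibrewiseConstant (hD : D.IsDerivator) :
    (D.shift I).DiaEquiv (fibrewiseConstant I D) where
  functor J _ := (constantOnFibres I D J).lift (D.shiftRes (first I) J) constantOnFibres_shiftRes
  isEquivalence J _ := by
    obtain ⟨h1, h2⟩ := hD.fullyFaithful_shiftRes_first (I := I) (J := J)
    refine
      { faithful := ⟨fun h => (D.shiftRes (first I) J).map_injective congr(($h).hom)⟩
        full := ⟨fun g => ⟨(D.shiftRes (first I) J).preimage g.hom,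
          ObjectProperty.hom_ext _ ((D.shiftRes (first I) J).map_preimage g.hom)⟩⟩
        essSurj := ⟨fun X => ?_⟩ }
    have h3 : (D.shiftRes (first I) J).essImage X.obj := by
      rw [hD.essImage_shiftRes_first]
      exact X.property
    exact ⟨_, ⟨ObjectProperty.isoMk _ h3.getIso⟩⟩
  resIso f := NatIso.ofComponents
    (fun Y => ObjectProperty.isoMk _ ((D.shiftResComm (first I) f).app Y))
    (fun φ => ObjectProperty.hom_ext _ ((D.shiftResComm (first I) f).hom.naturality φ))
  map_resSquare α Y := ObjectProperty.hom_ext _ ((shiftRes_map_resSquare (first I) α Y).trans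
    (congrArg₂ (· ≫ ·) rfl (congrArg₂ (· ≫ ·) rfl (fullSub_resSquare_app (D := D.shift (Chain I)ᵒᵖ)
      (hE := fun f X hX => constantOnFibres_res I D f X hX) α
      ⟨_, constantOnFibres_shiftRes Y⟩).symm)))

end

end HEpi

theorem proposition3p10 (I : Type w) [SmallCategory I] :
    HEpi.IsHomotopicalEpi.{w, v, u} (HEpi.first I) ∧
    ∀ D : HEpi.Prederivator.{w, v, u}, D.IsDerivator →
      (∀ (J : Type w) [SmallCategory J],
        (D.shiftRes (HEpi.first I) J).Full ∧ (D.shiftRes (HEpi.first I) J).Faithful ∧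
        (D.shiftRes (HEpi.first I) J).essImage = HEpi.constantOnFibres I D J) ∧
      (HEpi.fibrewiseConstant I D).IsDerivator := by
  refine ⟨fun D hD => ?_, fun D hD => ⟨fun J _ => ?_, ?_⟩⟩
  · have : (D.res ((HEpi.first I).prod (𝟭 HEpi.Pt))).Full :=
      hD.fullyFaithful_shiftRes_first.1
    have : (D.res ((HEpi.first I).prod (𝟭 HEpi.Pt))).Faithful :=
      hD.fullyFaithful_shiftRes_first.2
    exact HEpi.full_faithful_res_of_shiftRes _
  · obtain ⟨h1, h2⟩ := hD.fullyFaithful_shiftRes_first (I := I) (J := J)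
    exact ⟨h1, h2, hD.essImage_shiftRes_first⟩
  · exact (HEpi.equivFibrewiseConstant I hD).isDerivator (hD.shift I)
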